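/- **Theorem (finite $\eta$-convergence).** *Data.* Let $\mathcal K\subseteq\mathbb R^S\times\mathbb R_+$ be a full-dimensional closed convex cone with compact slice $\Xi=\{\xi\in\mathcal K:\xi_{S+1}=1\}$, let $\mathcal X\subseteq\mathbb R^{N_1}$, $c\in\mathbb R^{N_1}$, $\delta\in(0,1)$, $D,W_1,\dots,W_L\in\mathbb R^{N_2\times(S+1)}$, and let $T_1,\dots,T_L:\mathbb R^{N_1}\to\mathbb R^{S+1}$ be affine. Let $\xi'_1,\dots,\xi'_K\in\mathbb R^{S+1}$ ($K\ge1$) be constructor points, $\Xi_k=\{\xi\in\Xi:\|\xi-\xi_k'\|_2\le\|\xi-\xi_i'\|_2\ \forall i\ne k\}$ the Voronoi cells and $\mathcal K_k=\{\xi\in\mathcal K:2(\xi_i'-\xi_k')^\top\xi\le(\xi_i'^\top\xi_i'-\xi_k'^\top\xi_k')\,\xi_{S+1}\ \forall i\neq k\}$ their cones. Let $\hat\xi_1,\dots,\hat\xi_N\in\Xi$ be samples, each lying in exactly one cell, such that every cell contains a sample; let $\hat p_k$ be the fraction of the samples in $\Xi_k$ and $\hat\Omega_k$ the mean of $\hat\xi_i\hat\xi_i^\top$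 over the samples in $\Xi_k$. Let $\gamma\ge0$ and $\epsilon_k\ge0$ be the radii of the ambiguity sets. Write $e=\mathbf e_{S+1}$, $\mathcal C(\mathcal K_k)=\{A=A^\top: v^\top Av\ge0\ \forall v\in\mathcal K_k\}$ and $\mathcal C^*(\mathcal K_k)=\{\sum_i v_iv_i^\top: v_i\in\mathcal K_k\}$ (finite sums). Put $(\mathcal T_\ell,\mathcal W_\ell,\lambda_\ell,\kappa_\ell)=(T_\ell,W_\ell,0,0)$ for $\ell\le L$, $(0,0,1,0)$ for $\ell=L+1$, $(0,-D,1,1)$ for $\ell=L+2$, and $\Delta_\ell(x,Y,Q)=\frac12(\mathcal W_\ell^\top Y+Y^\top\mathcal W_\ell+\lambda_\ell Q+\lambda_\ell Q^\top-\mathcal T_\ell(x)e^\top-e\mathcal T_\ell(x)^\top)$. *Problem.* The second-stage problem is $\inf\{(D\xi)^\top y: T_\ell(x)^\top\xi\le(W_\ell\xi)^\top y\ \forall\ell\le L\}$. The piecewise decision rule problem is $$J^{\rm PDR}=\inf\ F:=c^\top x+\theta+\tfrac1\delta\bigl(\gamma\omega-\eta_0-2\hat p^\top r+2\omega\,\hat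 p^\top\mathbf e\bigr)$$ over $x\in\mathcal X$, $\theta,\eta_0\in\mathbb R$, $\omega\ge0$, $r,s\in\mathbb R^K$ with, for all $k$, $$(\ast)\quad s_k+\eta_0\le\omega,\qquad \sqrt{4r_k^2+(s_k+\eta_0)^2}\le2\omega-s_k-\eta_0,$$ and $Z_k(x,\theta)\le s_k$, where $Z_k(x,\theta)$ is the infimum of $\alpha+\operatorname{tr}(Q\hat\Omega_k)+\operatorname{tr}(B\hat\Omega_k)+\epsilon_k\|Q^\top+B\|_F$ over $Y,Q$, symmetric $B$, $\alpha\in\mathbb R$, $\pi\in\mathbb R^{L+2}$ subject to $\pi_\ell+\kappa_\ell\theta\ge0$, $\Delta_\ell(x,Y,Q)-\pi_\ell ee^\top\in\mathcal C(\mathcal K_k)$ for all $\ell\le L+2$, and $B+\alpha ee^\top\in\mathcal C(\mathcal K_k)$. *Subproblem.* Let $\Phi(x,\theta;H)=\frac12\sum_{\ell\le L+2}\operatorname{tr}\bigl(H_\ell(e\mathcal T_\ell(x)^\top+\mathcal T_\ell(x)e^\top)\bigr)-\sum_{\ell\le L+2}\kappa_\ell\theta\,e^\top H_\ell e$, and let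 $Z_k^*(x,\theta)$ be the supremum of $\Phi(x,\theta;H)$ over $G,O,H_1,\dots,H_{L+2}$ with $\|G\|_F\le\epsilon_k$, $\sum_\ell\mathcal W_\ell H_\ell=0$, $e^\top Oe=1$, $e^\top H_\ell e\ge0$, $\hat\Omega_k+G=O=\sum_\ell\lambda_\ell H_\ell$, and $O,H_\ell\in\mathcal C^*(\mathcal K_k)$. *Algorithm with tolerance $\eta$.* Start with $\overline J=\infty$ and empty cut sets $\mathcal V^k,\mathcal W^k$. In each iteration: 1. Solve the master problem: minimize $F$ over $x\in\mathcal X,\theta,\eta_0,\omega\ge0,r,s$ subject to $(\ast)$, $\Phi(x,\theta;H)\le s_k$ for $H\in\mathcal V^k$ and $\Phi(x,\theta;H)\le0$ for $H\in\mathcal W^k$, for all $k$. Let $\underline J$ be its optimal value and $(\hat x,\hat\theta,\hat s)$ be taken from an optimal solution. If there is none (the master problem is unbounded below, or its infimum is not attained), the solution of the $t$-th iteration is any feasible point with $F\le\max(\underline J,-1/a_t)+a_t$, where $a_t>0$, $a_t\to0$ is a prescribed sequence. 2. Let $\hat J$ be the infimum of $F$ over $\eta_0,\omega\ge0,r,s$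 subject to $(\ast)$ and $Z^*_k(\hat x,\hat\theta)\le s_k$ for all $k$, with $x=\hat x$, $\theta=\hat\theta$ fixed. If $\hat J<\overline J$, set $\overline J=\hat J$ and $(x^\star,\theta^\star)=(\hat x,\hat\theta)$. 3. If $\overline J,\underline J$ are finite and $\overline J-\underline J\le\eta\min(|\overline J|,|\underline J|)$, stop and output $(x^\star,\theta^\star)$. 4. For each $k$: if $Z_k^*(\hat x,\hat\theta)=\infty$, add to $\mathcal W^k$ the $H$-part of a maximizer of $\Phi(\hat x,\hat\theta;\cdot)$ over the homogenized subproblem constraints (those above with $e^\top Oe=0$ instead of $1$ and without $\hat\Omega_k$) together with the requirement that all entries of $G,O,H_\ell$ lie in $[-1,1]$; if $\hat s_k<Z_k^*(\hat x,\hat\theta)<\infty$, add to $\mathcal V^k$ the $H$-part of an optimal solution of the subproblem at $(\hat x,\hat\theta)$. *Claim.* Assume that $\mathcal X$ is nonempty and either compact and convex, or finite; that there is $Y\in\mathbb R^{N_2\times(S+1)}$ with $(W_\ell\xi)^\top Y\xi>0$ for all $\xi\in\Xi$, $\ell\le L$ (complete recourse under linear decision rules); that for all $x\in\mathcal X$,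 $\xi\in\Xi$ the linear programming dual of the second-stage problem is feasible (sufficiently expensive recourse); and that $J^{\rm PDR}\ne0$. Then for every $\eta>0$ every iteration of the algorithm can be carried out and every run of it stops after finitely many iterations, whatever optimal (or, where none exists, admissible approximate) solutions are chosen. When it stops, $x^\star\in\mathcal X$, and the objective value $v$ of the piecewise decision rule problem at $(x^\star,\theta^\star)$ (the infimum over its other variables) satisfies $\underline J\le J^{\rm PDR}\le v$ and $v-\underline J\le\eta\min(|v|,|\underline J|)$; if $\eta<2$, then $v-J^{\rm PDR}\le\eta|J^{\rm PDR}|$. -/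

import Mathlib

open Matrix Filter Topology

noncomputable section

namespace TwoStageDRO

/-- Index set of the semi-infinite constraints of the decision-rule problem: the `L` recourse
constraints, followed by the two constraints `0 ≤ τ` (`Sum.inr 0`) and
`(D ξ)ᵀ y - θ ≤ τ` (`Sum.inr 1`). -/
abbrev Idx (L : ℕ) := Fin L ⊕ Fin 2

/-- Real square matrices of order `S + 1`. -/
abbrev Mat (S : ℕ) := Matrix (Fin (S + 1)) (Fin (S + 1)) ℝ

/-- The last standard basis vector `e_{S+1}`. -/
def eLast (S : ℕ) : Fin (S + 1) → ℝ := Pi.single (Fin.last S) 1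

/-- Frobenius norm. -/
def frob {S : ℕ} (A : Mat S) : ℝ := Real.sqrt (∑ i, ∑ j, A i j ^ 2)

/-- The copositive cone with respect to `C`. -/
def Copositive {S : ℕ} (C : Set (Fin (S + 1) → ℝ)) : Set (Mat S) :=
  {A | A.IsSymm ∧ ∀ v ∈ C, 0 ≤ v ⬝ᵥ A *ᵥ v}

/-- The completely positive cone with respect to `C`: finite sums of `v vᵀ` with `v ∈ C`. -/
def CompletelyPositive {S : ℕ} (C : Set (Fin (S + 1) → ℝ)) : Set (Mat S) :=
  {A | ∃ (m : ℕ) (v : Fin m → Fin (S + 1) → ℝ),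
    (∀ i, v i ∈ C) ∧ A = ∑ i, vecMulVec (v i) (v i)}

/-- Data of the two-stage distributionally robust problem with random recourse, of its Voronoi
partition and of its data-driven ambiguity set. -/
structure Data (N₁ N₂ S L K N : ℕ) where
  /-- feasible set of the here-and-now decision -/
  X : Set (Fin N₁ → ℝ)
  /-- first-stage cost -/
  c : Fin N₁ → ℝ
  /-- CVaR level -/
  δ : ℝ
  /-- second-stage cost `(D ξ)ᵀ y` -/
  D : Matrix (Fin N₂) (Fin (S + 1)) ℝ
  /-- recourse matrices: the constraints are `T ℓ (x)ᵀ ξ ≤ (W ℓ ξ)ᵀ y` -/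
  W : Fin L → Matrix (Fin N₂) (Fin (S + 1)) ℝ
  /-- right-hand sides, affine in `x` -/
  T : Fin L → (Fin N₁ → ℝ) →ᵃ[ℝ] (Fin (S + 1) → ℝ)
  /-- closed convex cone whose slice is the support set -/
  cone : ProperCone ℝ (Fin (S + 1) → ℝ)
  /-- constructor points of the Voronoi partition -/
  ctr : Fin K → Fin (S + 1) → ℝ
  /-- historical samples -/
  sample : Fin N → Fin (S + 1) → ℝ
  /-- radius of the chi-square uncertainty set of the cell probabilities -/
  γ : ℝ
  /-- radii of the second-moment ambiguity sets in the cells -/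
  ε : Fin K → ℝ

namespace Data

variable {N₁ N₂ S L K N : ℕ} (P : Data N₁ N₂ S L K N)

/-- The support set `Ξ`: the slice of the cone at last coordinate `1`. -/
def support : Set (Fin (S + 1) → ℝ) := {ξ | ξ ∈ P.cone ∧ ξ (Fin.last S) = 1}

/-- The `k`-th Voronoi cell of the support set (Euclidean distances are compared through their
squares). -/
def cell (k : Fin K) : Set (Fin (S + 1) → ℝ) :=
  {ξ | ξ ∈ P.support ∧
    ∀ i, i ≠ k → (ξ - P.ctr k) ⬝ᵥ (ξ - P.ctr k) ≤ (ξ - P.ctr i) ⬝ᵥ (ξ - P.ctr i)}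

/-- The convex cone of the `k`-th cell: the defining inequalities of the cell, homogenized in the
last coordinate, so that its slice at last coordinate `1` is the cell. -/
def cellCone (k : Fin K) : Set (Fin (S + 1) → ℝ) :=
  {ξ | ξ ∈ P.cone ∧ ∀ i, i ≠ k →
    2 * ((P.ctr i - P.ctr k) ⬝ᵥ ξ) ≤
      (P.ctr i ⬝ᵥ P.ctr i - P.ctr k ⬝ᵥ P.ctr k) * ξ (Fin.last S)}

open Classical in
/-- Indices of the samples lying in the `k`-th cell. -/
def sampleIdx (k : Fin K) : Finset (Fin N) := Finset.univ.filter fun i => P.sample i ∈ P.cell k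

/-- Empirical cell probabilities. -/
def phat (k : Fin K) : ℝ := ((P.sampleIdx k).card : ℝ) / (N : ℝ)

/-- Empirical conditional second-moment matrices. -/
def omegaHat (k : Fin K) : Mat S :=
  ((P.sampleIdx k).card : ℝ)⁻¹ •
    ∑ i ∈ P.sampleIdx k, vecMulVec (P.sample i) (P.sample i)

/-- Standing assumptions on the data. -/
structure Standing : Prop where
  delta_pos : 0 < P.δ
  delta_lt_one : P.δ < 1
  /-- the cone lies in `ℝ^S × ℝ₊` -/
  cone_last : ∀ ξ ∈ P.cone, 0 ≤ ξ (Fin.last S)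
  /-- the cone is full-dimensional -/
  cone_interior : (interior (P.cone : Set (Fin (S + 1) → ℝ))).Nonempty
  support_compact : IsCompact P.support
  /-- there is at least one cell -/
  cells_pos : 0 < K
  sample_mem : ∀ i, P.sample i ∈ P.support
  /-- the samples are partitioned by the cells -/
  sample_unique : ∀ i k k', P.sample i ∈ P.cell k → P.sample i ∈ P.cell k' → k = k'
  /-- every cell contains a sample, so that its empirical conditional distribution exists -/
  sample_cell : ∀ k, ∃ i, P.sample i ∈ P.cell k
  gamma_nonneg : 0 ≤ P.γ
  eps_nonneg : ∀ k, 0 ≤ P.ε k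

/-- Complete recourse under linear decision rules. -/
def CompleteRecourseLDR : Prop :=
  ∃ Y : Matrix (Fin N₂) (Fin (S + 1)) ℝ,
    ∀ ξ ∈ P.support, ∀ ℓ, 0 < (P.W ℓ *ᵥ ξ) ⬝ᵥ (Y *ᵥ ξ)

/-- Sufficiently expensive recourse: for all `x` and `ξ` the linear programming dual of the
recourse problem `inf {(D ξ)ᵀ y : T ℓ (x)ᵀ ξ ≤ (W ℓ ξ)ᵀ y for all ℓ}`, that is
`sup {∑ ℓ, μ ℓ T ℓ (x)ᵀ ξ : μ ≥ 0, ∑ ℓ, μ ℓ W ℓ ξ = D ξ}`, is feasible. -/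
def SufficientlyExpensiveRecourse : Prop :=
  ∀ x ∈ P.X, ∀ ξ ∈ P.support,
    ∃ μ : Fin L → ℝ, (∀ ℓ, 0 ≤ μ ℓ) ∧ ∑ ℓ, μ ℓ • (P.W ℓ *ᵥ ξ) = P.D *ᵥ ξ

/-! Coefficients of the `L + 2` constraints. -/

/-- The vectors `𝒯_ℓ(x)`. -/
def calT (x : Fin N₁ → ℝ) : Idx L → Fin (S + 1) → ℝ
  | Sum.inl ℓ => P.T ℓ x
  | Sum.inr _ => 0

/-- The matrices `𝒲_ℓ`. -/
def calW : Idx L → Matrix (Fin N₂) (Fin (S + 1)) ℝ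
  | Sum.inl ℓ => P.W ℓ
  | Sum.inr j => if j = 0 then 0 else -P.D

end Data

/-- The coefficients `λ_ℓ`. -/
def lam {L : ℕ} : Idx L → ℝ
  | Sum.inl _ => 0
  | Sum.inr _ => 1

/-- The coefficients `κ_ℓ`. -/
def kap {L : ℕ} : Idx L → ℝ
  | Sum.inl _ => 0
  | Sum.inr j => if j = 0 then 0 else 1

namespace Data

variable {N₁ N₂ S L K N : ℕ} (P : Data N₁ N₂ S L K N)

/-- The affine matrix functions `Δ_ℓ(x, Y, Q)`. -/
def DeltaMat (x : Fin N₁ → ℝ) (Y : Matrix (Fin N₂) (Fin (S + 1)) ℝ) (Q : Mat S) (ℓ : Idx L) :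
    Mat S :=
  (1 / 2 : ℝ) • ((P.calW ℓ)ᵀ * Y + Yᵀ * P.calW ℓ + lam ℓ • Q + lam ℓ • Qᵀ
    - vecMulVec (P.calT x ℓ) (eLast S) - vecMulVec (eLast S) (P.calT x ℓ))

/-- Optimal value `Z_k(x, θ)` of the copositive program of the `k`-th cell. -/
def Zprimal (k : Fin K) (x : Fin N₁ → ℝ) (θ : ℝ) : EReal :=
  sInf {v | ∃ (Y : Matrix (Fin N₂) (Fin (S + 1)) ℝ) (Q B : Mat S) (α : ℝ) (q : Idx L → ℝ),
    B.IsSymm ∧ (∀ ℓ, 0 ≤ q ℓ + kap ℓ * θ) ∧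
    (∀ ℓ, P.DeltaMat x Y Q ℓ - q ℓ • vecMulVec (eLast S) (eLast S) ∈ Copositive (P.cellCone k)) ∧
    B + α • vecMulVec (eLast S) (eLast S) ∈ Copositive (P.cellCone k) ∧
    v = ((α + trace (Q * P.omegaHat k) + trace (B * P.omegaHat k) + P.ε k * frob (Qᵀ + B) : ℝ) :
      EReal)}

/-- Objective of the completely positive subproblem; also the left-hand side of the cuts. -/
def dualObj (x : Fin N₁ → ℝ) (θ : ℝ) (H : Idx L → Mat S) : ℝ :=
  (1 / 2) * ∑ ℓ, trace (H ℓ * (vecMulVec (eLast S) (P.calT x ℓ) + vecMulVec (P.calT x ℓ) (eLast S)))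
    - ∑ ℓ, kap ℓ * θ * (eLast S ⬝ᵥ H ℓ *ᵥ eLast S)

/-- Feasible points of the completely positive subproblem of the `k`-th cell. -/
structure SubFeasible (k : Fin K) (G O : Mat S) (H : Idx L → Mat S) : Prop where
  norm_le : frob G ≤ P.ε k
  recourse : ∑ ℓ, P.calW ℓ * H ℓ = 0
  mass : eLast S ⬝ᵥ O *ᵥ eLast S = 1
  last_nonneg : ∀ ℓ, 0 ≤ eLast S ⬝ᵥ H ℓ *ᵥ eLast S
  eqO : P.omegaHat k + G - O = 0
  eqH : P.omegaHat k + G - ∑ ℓ, (lam ℓ : ℝ) • H ℓ = 0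
  memO : O ∈ CompletelyPositive (P.cellCone k)
  memH : ∀ ℓ, H ℓ ∈ CompletelyPositive (P.cellCone k)

/-- Optimal value `Z_k^*(x, θ)` of the completely positive subproblem of the `k`-th cell. -/
def Zdual (k : Fin K) (x : Fin N₁ → ℝ) (θ : ℝ) : EReal :=
  sSup {v | ∃ G O H, P.SubFeasible k G O H ∧ v = ((P.dualObj x θ H : ℝ) : EReal)}

/-- `H` is the `H`-part of an optimal solution of the subproblem at `(x, θ)`. -/
def IsOptimalityCut (k : Fin K) (x : Fin N₁ → ℝ) (θ : ℝ) (H : Idx L → Mat S) : Prop :=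
  ∃ G O, P.SubFeasible k G O H ∧
    ∀ G' O' H', P.SubFeasible k G' O' H' → P.dualObj x θ H' ≤ P.dualObj x θ H

/-- Feasible points of the problem that generates the feasibility cuts. -/
structure RayFeasible (k : Fin K) (G O : Mat S) (H : Idx L → Mat S) : Prop where
  norm_le : frob G ≤ P.ε k
  recourse : ∑ ℓ, P.calW ℓ * H ℓ = 0
  mass : eLast S ⬝ᵥ O *ᵥ eLast S = 0
  last_nonneg : ∀ ℓ, 0 ≤ eLast S ⬝ᵥ H ℓ *ᵥ eLast S
  eqO : G - O = 0
  eqH : G - ∑ ℓ, (lam ℓ : ℝ) • H ℓ = 0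
  memO : O ∈ CompletelyPositive (P.cellCone k)
  memH : ∀ ℓ, H ℓ ∈ CompletelyPositive (P.cellCone k)
  boundG : ∀ i j, |G i j| ≤ 1
  boundO : ∀ i j, |O i j| ≤ 1
  boundH : ∀ ℓ i j, |H ℓ i j| ≤ 1

/-- `H` is the `H`-part of an optimal solution of the feasibility-cut problem at `(x, θ)`. -/
def IsFeasibilityCut (k : Fin K) (x : Fin N₁ → ℝ) (θ : ℝ) (H : Idx L → Mat S) : Prop :=
  ∃ G O, P.RayFeasible k G O H ∧
    ∀ G' O' H', P.RayFeasible k G' O' H' → P.dualObj x θ H' ≤ P.dualObj x θ H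

end Data

/-- Values of the variables `x, θ, η, ω, r, s` of the master problem (`η` is written `eta`). -/
structure MasterPoint (N₁ K : ℕ) where
  x : Fin N₁ → ℝ
  θ : ℝ
  eta : ℝ
  ω : ℝ
  r : Fin K → ℝ
  s : Fin K → ℝ

/-- The constraints on `η, ω, r, s` common to both problems. -/
def MasterPoint.ConicFeasible {N₁ K : ℕ} (z : MasterPoint N₁ K) : Prop :=
  0 ≤ z.ω ∧ ∀ k, z.s k + z.eta ≤ z.ω ∧
    Real.sqrt (4 * z.r k ^ 2 + (z.s k + z.eta) ^ 2) ≤ 2 * z.ω - z.s k - z.eta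

/-- State of the algorithm at the beginning of an iteration: the sets of optimality and of
feasibility cuts, the upper bound and the incumbent. -/
structure AlgState (N₁ S L K : ℕ) where
  V : Fin K → Set (Idx L → Mat S)
  W : Fin K → Set (Idx L → Mat S)
  ub : EReal
  inc : Option ((Fin N₁ → ℝ) × ℝ)

/-- The initial state: no cuts, upper bound `∞`, no incumbent. -/
def AlgState.init (N₁ S L K : ℕ) : AlgState N₁ S L K where
  V := fun _ => ∅
  W := fun _ => ∅
  ub := ⊤
  inc := none

namespace Data

variable {N₁ N₂ S L K N : ℕ} (P : Data N₁ N₂ S L K N)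

/-- Common objective of the decision-rule problem and of the master problem. -/
def obj (z : MasterPoint N₁ K) : ℝ :=
  P.c ⬝ᵥ z.x + z.θ + (1 / P.δ) *
    (P.γ * z.ω - z.eta - 2 * (P.phat ⬝ᵥ z.r) + 2 * z.ω * ∑ k, P.phat k)

/-- Optimal value of the problem of minimizing the objective subject to the conic constraints and to
`ζ k ≤ s k` for all `k`, when `(x, θ)` is fixed. -/
def fixedValue (ζ : Fin K → EReal) (x : Fin N₁ → ℝ) (θ : ℝ) : EReal :=
  sInf {v | ∃ z : MasterPoint N₁ K, z.x = x ∧ z.θ = θ ∧ z.ConicFeasible ∧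
    (∀ k, ζ k ≤ (z.s k : EReal)) ∧ v = (P.obj z : EReal)}

/-- Objective value of the piecewise decision rule problem at `(x, θ)`. -/
def pdrValue (x : Fin N₁ → ℝ) (θ : ℝ) : EReal := P.fixedValue (fun k => P.Zprimal k x θ) x θ

/-- Optimal value `J^PDR` of the piecewise decision rule problem. -/
def JPDR : EReal :=
  sInf {v | ∃ z : MasterPoint N₁ K, z.x ∈ P.X ∧ z.ConicFeasible ∧
    (∀ k, P.Zprimal k z.x z.θ ≤ (z.s k : EReal)) ∧ v = (P.obj z : EReal)}

/-- Feasible points of the master problem at a state. -/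
structure MasterFeasible (st : AlgState N₁ S L K) (z : MasterPoint N₁ K) : Prop where
  mem : z.x ∈ P.X
  conic : z.ConicFeasible
  optCuts : ∀ k, ∀ H ∈ st.V k, P.dualObj z.x z.θ H ≤ z.s k
  feasCuts : ∀ k, ∀ H ∈ st.W k, P.dualObj z.x z.θ H ≤ 0

/-- Optimal value of the master problem, the lower bound of the iteration. -/
def masterValue (st : AlgState N₁ S L K) : EReal :=
  sInf {v | ∃ z, P.MasterFeasible st z ∧ v = (P.obj z : EReal)}

/-- `z` is an optimal solution of the master problem. -/
def IsMasterOptimal (st : AlgState N₁ S L K) (z : MasterPoint N₁ K) : Prop :=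
  P.MasterFeasible st z ∧ ∀ z', P.MasterFeasible st z' → P.obj z ≤ P.obj z'

/-- `z` is an admissible outcome of solving the master problem: an optimal solution if there is
one; otherwise (the master problem is unbounded below or its infimum is not attained) a feasible
point whose objective value is within `a` of the infimum, respectively of `-1 / a` if the infimum
is smaller than that. -/
def IsMasterOutput (a : ℝ) (st : AlgState N₁ S L K) (z : MasterPoint N₁ K) : Prop :=
  P.IsMasterOptimal st z ∨
    ((¬ ∃ z', P.IsMasterOptimal st z') ∧ P.MasterFeasible st z ∧
      (P.obj z : EReal) ≤ max (P.masterValue st) ((-(1 / a) : ℝ) : EReal) + (a : EReal))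

/-- The candidate upper bound at the master point: the objective value at `(x, θ)`, computed
from the values of the subproblems. -/
def candidate (z : MasterPoint N₁ K) : EReal :=
  P.fixedValue (fun k => P.Zdual k z.x z.θ) z.x z.θ

open Classical in
/-- The upper bound after its update. -/
def newUb (st : AlgState N₁ S L K) (z : MasterPoint N₁ K) : EReal :=
  if P.candidate z < st.ub then P.candidate z else st.ub

open Classical in
/-- The incumbent after its update. -/
def newInc (st : AlgState N₁ S L K) (z : MasterPoint N₁ K) : Option ((Fin N₁ → ℝ) × ℝ) :=
  if P.candidate z < st.ub then some (z.x, z.θ) else st.inc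

/-- The stopping test with tolerance `tol`: both bounds are finite and their gap is at most `tol`
times the smaller of their absolute values. -/
def Stops (tol : ℝ) (st : AlgState N₁ S L K) (z : MasterPoint N₁ K) : Prop :=
  ∃ u l : ℝ, P.newUb st z = (u : EReal) ∧ P.masterValue st = (l : EReal) ∧
    u - l ≤ tol * min |u| |l|

/-- `st'` is a state after the upper bound and the cut sets have been updated. -/
def Updates (st : AlgState N₁ S L K) (z : MasterPoint N₁ K) (st' : AlgState N₁ S L K) : Prop :=
  st'.ub = P.newUb st z ∧ st'.inc = P.newInc st z ∧
  ∀ k,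
    (P.Zdual k z.x z.θ = ⊤ ∧ ∃ H, P.IsFeasibilityCut k z.x z.θ H ∧
      st'.W k = insert H (st.W k) ∧ st'.V k = st.V k) ∨
    ((z.s k : EReal) < P.Zdual k z.x z.θ ∧ P.Zdual k z.x z.θ < ⊤ ∧
      ∃ H, P.IsOptimalityCut k z.x z.θ H ∧
        st'.V k = insert H (st.V k) ∧ st'.W k = st.W k) ∨
    (P.Zdual k z.x z.θ ≤ (z.s k : EReal) ∧ st'.V k = st.V k ∧ st'.W k = st.W k)

/-- One complete iteration that does not stop. -/
def Step (tol a : ℝ) (st st' : AlgState N₁ S L K) : Prop :=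
  ∃ z, P.IsMasterOutput a st z ∧ ¬ P.Stops tol st z ∧ P.Updates st z st'

/-- `Reachable tol acc t st`: some run of the algorithm is in state `st` after `t` complete
iterations; `acc t` is the accuracy used in iteration `t` if the master problem has no optimal
solution. -/
inductive Reachable (tol : ℝ) (acc : ℕ → ℝ) : ℕ → AlgState N₁ S L K → Prop
  | start : Reachable tol acc 0 (AlgState.init N₁ S L K)
  | step {t : ℕ} {st st' : AlgState N₁ S L K} :
      Reachable tol acc t st → P.Step tol (acc t) st st' → Reachable tol acc (t + 1) st'

end Data

end TwoStageDRO

end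

namespace TwoStageDRO

/-! Compactness of the subproblems drives everything. A nonzero vector of the cone has positive last
coordinate, so every vector of a cell cone is a nonnegative multiple of a point of the compact cell.
Hence the completely positive cone of a cell has the convex hull of the matrices `ξ ξᵀ` as a compact
base, and the last diagonal entry of an element (its mass) controls its size (`isCompact_cp`).
Pairing the recourse equation with the decision rule from complete recourse bounds all masses by
those of `H (inr 0)` and `H (inr 1)`, which add up to 1. So the feasible set of each subproblem is
compact, nonempty and independent of `(x, θ)` (`isCompact_subSet`). Its value is therefore finite
and attained, feasibility cuts never arise, and separation yields strong duality
(`Zprimal_eq_Zdual`). Master values are thus lower bounds for `JPDR`, and candidates are true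
objective values.

In an infinite run the maximizers accumulate. A late one is close to an earlier one that is already
a cut, and the objective is Lipschitz in `H` with a constant proportional to `1 + |θ|`; so at some
late iteration all violations are small relative to `1 + |θ|` (`exists_small_violation`). Raising
`s` and lowering `eta` repairs such violations at small cost. Expensive recourse makes `Z_k` grow at
unit rate as `θ` decreases, so, since `1 / δ > 1`, the objective is coercive in `θ`
(`exists_coercive`). Hence `θ` is bounded at that iteration and the absolute gap is small. Because
`JPDR ≠ 0`, both bounds then stay away from zero and the relative test succeeds
(`not_exists_infinite_run`). An unbounded master problem would push a true objective value below
`JPDR`. -/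

/-! ### Compact convex hulls and the trace pairing -/

theorem isCompact_convexHull_of_finiteDimensional {E : Type*} [AddCommGroup E] [Module ℝ E]
    [TopologicalSpace E] [IsTopologicalAddGroup E] [ContinuousSMul ℝ E] [FiniteDimensional ℝ E]
    {s : Set E} (hs : IsCompact s) : IsCompact (convexHull ℝ s) := by
  let F : ∀ n : ℕ, (Fin n → ℝ) × (Fin n → E) → E := fun n p => ∑ i, p.1 i • p.2 i
  have hF : ∀ n, Continuous (F n) := fun n => by
    refine continuous_finsetSum _ fun i _ => ?_
    exact ((continuous_apply i).comp continuous_fst).smul ((continuous_apply i).comp continuous_snd)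
  have hK : ∀ n, IsCompact (F n '' (stdSimplex ℝ (Fin n) ×ˢ Set.univ.pi fun _ => s)) := fun n =>
    ((isCompact_stdSimplex ℝ (Fin n)).prod (isCompact_univ_pi fun _ => hs)).image (hF n)
  -- Carathéodory: at most `finrank + 1` points are needed, so the hull is a finite union of
  -- continuous images of compact sets.
  have heq : convexHull ℝ s = ⋃ n ∈ Finset.range (Module.finrank ℝ E + 2),
      F n '' (stdSimplex ℝ (Fin n) ×ˢ Set.univ.pi fun _ => s) := by
    apply Set.Subset.antisymm
    · intro x hx
      obtain ⟨ι, _, z, w, hz, hai, hw, hsum, hx⟩ := eq_pos_convex_span_of_mem_convexHull hx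
      have hcard : Fintype.card ι ≤ Module.finrank ℝ E + 1 :=
        hai.card_le_finrank_succ.trans (Nat.succ_le_succ (Submodule.finrank_le _))
      let e := Fintype.equivFin ι
      simp only [Set.mem_iUnion]
      refine ⟨Fintype.card ι, Finset.mem_range.2 (by omega),
        (fun i => w (e.symm i), fun i => z (e.symm i)), ⟨⟨fun i => (hw _).le, ?_⟩, ?_⟩, ?_⟩
      · rw [← hsum]; exact e.symm.sum_comp w
      · intro i _; exact hz ⟨_, rfl⟩
      · rw [← hx]; exact e.symm.sum_comp fun i => w i • z i
    · intro x hx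
      simp only [Set.mem_iUnion] at hx
      obtain ⟨n, _, p, ⟨hp1, hp2⟩, rfl⟩ := hx
      exact (convex_convexHull ℝ s).sum_mem (fun i _ => hp1.1 i) hp1.2
        fun i _ => subset_convexHull ℝ s (hp2 i trivial)
  rw [heq]
  exact (Finset.range _).isCompact_biUnion fun n _ => hK n

theorem exists_trace_mul_eq {m n : Type*} [Fintype m] [Fintype n] [DecidableEq m] [DecidableEq n]
    (g : Matrix m n ℝ →ₗ[ℝ] ℝ) : ∃ Y : Matrix m n ℝ, ∀ U, g U = trace (Yᵀ * U) := by
  refine ⟨of fun i j => g (Matrix.single i j 1), fun U => ?_⟩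
  conv_lhs => rw [Matrix.matrix_eq_sum_single U]
  simp only [map_sum, trace, diag_apply, mul_apply, transpose_apply, of_apply]
  rw [Finset.sum_comm]
  refine Finset.sum_congr rfl fun j _ => Finset.sum_congr rfl fun i _ => ?_
  have : Matrix.single i j (U i j) = U i j • Matrix.single i j (1 : ℝ) := by
    rw [Matrix.smul_single, smul_eq_mul, mul_one]
  rw [this, map_smul, smul_eq_mul, mul_comm]

theorem trace_mul_vecMulVec {n : Type*} [Fintype n] (M : Matrix n n ℝ) (v w : n → ℝ) :
    trace (M * vecMulVec v w) = w ⬝ᵥ M *ᵥ v := by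
  rw [mul_vecMulVec, trace_vecMulVec, dotProduct_comm]

/-! ### Frobenius norm -/

section Frobenius

variable {S : ℕ}

theorem frob_eq_norm (A : Mat S) : frob A =
    ‖(WithLp.toLp 2 fun p : Fin (S + 1) × Fin (S + 1) => A p.1 p.2 :
      EuclideanSpace ℝ (Fin (S + 1) × Fin (S + 1)))‖ := by
  rw [EuclideanSpace.norm_eq, frob, Fintype.sum_prod_type]
  simp

theorem frob_nonneg (A : Mat S) : 0 ≤ frob A := Real.sqrt_nonneg _

theorem frob_add_le (A B : Mat S) : frob (A + B) ≤ frob A + frob B := by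
  simp only [frob_eq_norm]
  exact norm_add_le (WithLp.toLp 2 fun p : Fin (S + 1) × Fin (S + 1) => A p.1 p.2)
    (WithLp.toLp 2 fun p : Fin (S + 1) × Fin (S + 1) => B p.1 p.2)

theorem frob_smul (a : ℝ) (A : Mat S) : frob (a • A) = |a| * frob A := by
  simp only [frob_eq_norm]
  exact norm_smul a (WithLp.toLp 2 fun p : Fin (S + 1) × Fin (S + 1) => A p.1 p.2 :
      EuclideanSpace ℝ (Fin (S + 1) × Fin (S + 1)))

theorem abs_apply_le_frob (A : Mat S) (i j : Fin (S + 1)) : |A i j| ≤ frob A := by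
  rw [frob_eq_norm]
  exact PiLp.norm_apply_le (WithLp.toLp 2 fun p : Fin (S + 1) × Fin (S + 1) => A p.1 p.2 :
      EuclideanSpace ℝ (Fin (S + 1) × Fin (S + 1))) (i, j)

theorem frob_zero : frob (0 : Mat S) = 0 := by simp [frob]

theorem frob_sq (A : Mat S) : frob A * frob A = ∑ i, ∑ j, A i j ^ 2 :=
  Real.mul_self_sqrt (Finset.sum_nonneg fun _ _ => Finset.sum_nonneg fun _ _ => sq_nonneg _)

theorem continuous_frob : Continuous (frob : Mat S → ℝ) := by
  unfold frob
  fun_prop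

theorem trace_mul_le_frob (M G : Mat S) : trace (M * G) ≤ frob Mᵀ * frob G := by
  have h1 : trace (M * G) = ∑ p : Fin (S + 1) × Fin (S + 1), Mᵀ p.1 p.2 * G p.1 p.2 := by
    rw [Fintype.sum_prod_type, Finset.sum_comm]
    simp [trace, mul_apply]
  rw [h1]
  refine (Real.sum_mul_le_sqrt_mul_sqrt _ _ _).trans (le_of_eq ?_)
  simp only [frob, Fintype.sum_prod_type]

theorem isCompact_frob_le (r : ℝ) : IsCompact {G : Mat S | frob G ≤ r} := by
  have hK : IsCompact (Set.univ.pi fun _ => Set.univ.pi fun _ => Set.Icc (-r) r :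
      Set (Fin (S + 1) → Fin (S + 1) → ℝ)) :=
    isCompact_univ_pi fun _ => isCompact_univ_pi fun _ => isCompact_Icc
  refine IsCompact.of_isClosed_subset hK (isClosed_le continuous_frob continuous_const) ?_
  intro G hG i _ j _
  exact abs_le.1 ((abs_apply_le_frob G i j).trans hG)

/-- Frobenius duality: the norm of a symmetric matrix is attained by a symmetric matrix. -/
theorem exists_frob_le_trace_eq {A : Mat S} (hA : A.IsSymm) {r : ℝ} (hr : 0 ≤ r) :
    ∃ G : Mat S, G.IsSymm ∧ frob G ≤ r ∧ trace (A * G) = r * frob A := by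
  rcases (frob_nonneg A).eq_or_lt with h | h
  · exact ⟨0, by simp [IsSymm], by rwa [frob_zero], by simp [← h]⟩
  · refine ⟨(r / frob A) • A, by rw [IsSymm, transpose_smul, hA.eq], ?_, ?_⟩
    · rw [frob_smul, abs_of_nonneg (by positivity), div_mul_cancel₀ _ h.ne']
    · rw [Matrix.mul_smul, trace_smul, smul_eq_mul]
      have : trace (A * A) = frob A * frob A := by
        rw [frob_sq]
        conv_lhs => rw [← hA.eq]
        simp only [trace, diag_apply, mul_apply, transpose_apply]
        rw [Finset.sum_comm]
        refine Finset.sum_congr rfl fun i _ => Finset.sum_congr rfl fun j _ => ?_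
        rw [hA.apply, sq]
      rw [this]; field_simp

end Frobenius

/-! ### The last diagonal entry of a matrix, called its mass -/

section Mass

variable {S : ℕ}

theorem mass_eq (A : Mat S) : eLast S ⬝ᵥ A *ᵥ eLast S = A (Fin.last S) (Fin.last S) := by
  simp [eLast]

theorem eLast_dotProduct (v : Fin (S + 1) → ℝ) : eLast S ⬝ᵥ v = v (Fin.last S) := by
  simp [eLast]

theorem quad_eLast (v : Fin (S + 1) → ℝ) :
    v ⬝ᵥ vecMulVec (eLast S) (eLast S) *ᵥ v = v (Fin.last S) ^ 2 := by
  rw [vecMulVec_mulVec, eLast_dotProduct]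
  simp [eLast, sq]

end Mass

/-! ### The completely positive cone -/

namespace CompletelyPositive

variable {S : ℕ} {C : Set (Fin (S + 1) → ℝ)} {A B : Mat S}

theorem zero_mem : (0 : Mat S) ∈ CompletelyPositive C :=
  ⟨0, fun i => i.elim0, fun i => i.elim0, by simp⟩

theorem vecMulVec_mem {v : Fin (S + 1) → ℝ} (hv : v ∈ C) :
    vecMulVec v v ∈ CompletelyPositive C :=
  ⟨1, fun _ => v, fun _ => hv, by simp⟩

theorem add_mem (hA : A ∈ CompletelyPositive C) (hB : B ∈ CompletelyPositive C) :
    A + B ∈ CompletelyPositive C := by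
  obtain ⟨m, v, hv, rfl⟩ := hA
  obtain ⟨n, w, hw, rfl⟩ := hB
  refine ⟨m + n, Fin.append v w, fun i => ?_, ?_⟩
  · refine Fin.addCases (fun i => ?_) (fun i => ?_) i
    · rw [Fin.append_left]; exact hv i
    · rw [Fin.append_right]; exact hw i
  · simp [Fin.sum_univ_add]

theorem smul_mem (hC : ∀ a : ℝ, 0 ≤ a → ∀ v ∈ C, a • v ∈ C) {a : ℝ} (ha : 0 ≤ a)
    (hA : A ∈ CompletelyPositive C) : a • A ∈ CompletelyPositive C := by
  obtain ⟨m, v, hv, rfl⟩ := hA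
  refine ⟨m, fun i => Real.sqrt a • v i, fun i => hC _ (Real.sqrt_nonneg a) _ (hv i), ?_⟩
  rw [Finset.smul_sum]
  refine Finset.sum_congr rfl fun i _ => ?_
  rw [vecMulVec_smul, smul_vecMulVec, smul_smul, Real.mul_self_sqrt ha]

theorem sum_mem {ι : Type*} {s : Finset ι} {f : ι → Mat S}
    (h : ∀ i ∈ s, f i ∈ CompletelyPositive C) : ∑ i ∈ s, f i ∈ CompletelyPositive C :=
  Finset.sum_induction f (· ∈ CompletelyPositive C) (fun _ _ => add_mem) zero_mem h

theorem isSymm (hA : A ∈ CompletelyPositive C) : A.IsSymm := by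
  obtain ⟨m, v, -, rfl⟩ := hA
  rw [IsSymm, transpose_sum]
  exact Finset.sum_congr rfl fun i _ => by rw [transpose_vecMulVec]

theorem trace_mul_nonneg {M : Mat S} (hM : ∀ v ∈ C, 0 ≤ v ⬝ᵥ M *ᵥ v)
    (hA : A ∈ CompletelyPositive C) : 0 ≤ trace (M * A) := by
  obtain ⟨m, v, hv, rfl⟩ := hA
  rw [Finset.mul_sum, trace_sum]
  exact Finset.sum_nonneg fun i _ => by rw [trace_mul_vecMulVec]; exact hM _ (hv i)

theorem last_nonneg (hA : A ∈ CompletelyPositive C) : 0 ≤ A (Fin.last S) (Fin.last S) := by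
  have h := trace_mul_nonneg (M := vecMulVec (eLast S) (eLast S))
    (fun v _ => by rw [quad_eLast]; positivity) hA
  rwa [trace_mul_comm, trace_mul_vecMulVec, mass_eq] at h

end CompletelyPositive

/-! ### Cells, their cones and compact bases -/

namespace Data

variable {N₁ N₂ S L K N : ℕ} {P : Data N₁ N₂ S L K N}

theorem smul_mem_cellCone {k : Fin K} (a : ℝ) (ha : 0 ≤ a) (v : Fin (S + 1) → ℝ)
    (hv : v ∈ P.cellCone k) : a • v ∈ P.cellCone k := by
  refine ⟨P.cone.smul_mem hv.1 ha, fun i hi => ?_⟩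
  have h := mul_le_mul_of_nonneg_left (hv.2 i hi) ha
  simp only [dotProduct_smul, Pi.smul_apply, smul_eq_mul]
  linarith

theorem dist_le_iff {S : ℕ} (ξ a b : Fin (S + 1) → ℝ) (h : ξ (Fin.last S) = 1) :
    (ξ - a) ⬝ᵥ (ξ - a) ≤ (ξ - b) ⬝ᵥ (ξ - b) ↔
      2 * ((b - a) ⬝ᵥ ξ) ≤ (b ⬝ᵥ b - a ⬝ᵥ a) * ξ (Fin.last S) := by
  rw [h]
  simp only [sub_dotProduct, dotProduct_sub, dotProduct_comm ξ]
  constructor <;> intro h <;> linarith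

theorem mem_cell_iff {k : Fin K} {ξ : Fin (S + 1) → ℝ} :
    ξ ∈ P.cell k ↔ ξ ∈ P.cellCone k ∧ ξ (Fin.last S) = 1 := by
  constructor
  · rintro ⟨⟨h1, h2⟩, h3⟩
    exact ⟨⟨h1, fun i hi => (dist_le_iff ξ _ _ h2).1 (h3 i hi)⟩, h2⟩
  · rintro ⟨⟨h1, h3⟩, h2⟩
    exact ⟨⟨h1, h2⟩, fun i hi => (dist_le_iff ξ _ _ h2).2 (h3 i hi)⟩

theorem isCompact_cell (hP : P.Standing) (k : Fin K) : IsCompact (P.cell k) := by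
  have : P.cell k = P.support ∩ ⋂ i, ⋂ (_ : i ≠ k),
      {ξ | (ξ - P.ctr k) ⬝ᵥ (ξ - P.ctr k) ≤ (ξ - P.ctr i) ⬝ᵥ (ξ - P.ctr i)} := by
    ext ξ; simp [cell]
  rw [this]
  refine hP.support_compact.inter_right (isClosed_iInter fun i => isClosed_iInter fun _ => ?_)
  apply isClosed_le <;> simp only [dotProduct] <;> fun_prop

theorem support_nonempty (hP : P.Standing) : P.support.Nonempty := by
  obtain ⟨i, hi⟩ := hP.sample_cell ⟨0, hP.cells_pos⟩
  exact ⟨_, hi.1⟩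

theorem cell_nonempty (hP : P.Standing) (k : Fin K) : (P.cell k).Nonempty := by
  obtain ⟨i, hi⟩ := hP.sample_cell k
  exact ⟨_, hi⟩

/-- Such a `v` is a recession direction of the support, which is bounded. -/
theorem eq_zero_of_last_eq_zero (hP : P.Standing) {v : Fin (S + 1) → ℝ} (hv : v ∈ P.cone)
    (h0 : v (Fin.last S) = 0) : v = 0 := by
  obtain ⟨ξ, hξ⟩ := support_nonempty hP
  obtain ⟨C, hC⟩ := hP.support_compact.isBounded.exists_norm_le
  have hmem : ∀ a : ℝ, 0 ≤ a → ξ + a • v ∈ P.support := fun a ha =>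
    ⟨P.cone.add_mem hξ.1 (P.cone.smul_mem hv ha), by simp [h0, hξ.2]⟩
  by_contra hne
  have hpos : 0 < ‖v‖ := norm_pos_iff.2 hne
  have h1 := hC _ hξ
  have hC0 : 0 ≤ C := (norm_nonneg _).trans h1
  -- This step has length `2 * C + 1`, more than the distance between two points of norm at most
  -- `C`.
  have h2 := hC _ (hmem ((2 * C + 1) / ‖v‖) (by positivity))
  have h3 : ‖((2 * C + 1) / ‖v‖) • v‖ = 2 * C + 1 := by
    rw [norm_smul, Real.norm_of_nonneg (by positivity), div_mul_cancel₀ _ hpos.ne']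
  have h4 := norm_sub_le (ξ + ((2 * C + 1) / ‖v‖) • v) ξ
  rw [add_sub_cancel_left] at h4
  linarith

theorem exists_smul_cell (hP : P.Standing) {k : Fin K} {v : Fin (S + 1) → ℝ}
    (hv : v ∈ P.cellCone k) :
    ∃ a : ℝ, 0 ≤ a ∧ ∃ ξ ∈ P.cell k, v = a • ξ := by
  rcases (hP.cone_last v hv.1).eq_or_lt with h | h
  · obtain ⟨ξ, hξ⟩ := cell_nonempty hP k
    exact ⟨0, le_rfl, ξ, hξ, by rw [zero_smul, eq_zero_of_last_eq_zero hP hv.1 h.symm]⟩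
  · refine ⟨v (Fin.last S), h.le, (v (Fin.last S))⁻¹ • v, mem_cell_iff.2
      ⟨smul_mem_cellCone _ (by positivity) _ hv, ?_⟩, ?_⟩
    · simp [h.ne']
    · rw [smul_smul, mul_inv_cancel₀ h.ne', one_smul]

theorem quad_nonneg_of_cell (hP : P.Standing) {k : Fin K} {M : Mat S}
    (hM : ∀ ξ ∈ P.cell k, 0 ≤ ξ ⬝ᵥ M *ᵥ ξ) : ∀ v ∈ P.cellCone k, 0 ≤ v ⬝ᵥ M *ᵥ v := by
  intro v hv
  obtain ⟨a, ha, ξ, hξ, rfl⟩ := exists_smul_cell hP hv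
  rw [mulVec_smul, dotProduct_smul, smul_dotProduct, smul_eq_mul, smul_eq_mul]
  exact mul_nonneg ha (mul_nonneg ha (hM ξ hξ))

/-- On the cell the form of `eLast eLastᵀ` equals 1, so `M - c eLast eLastᵀ` is nonnegative on the
cell and, by homogeneity, on its cone. This turns pointwise bounds over a cell into bounds by mass.
-/
theorem mul_mass_le_trace (hP : P.Standing) {k : Fin K} {M A : Mat S} {c : ℝ}
    (hM : ∀ ξ ∈ P.cell k, c ≤ ξ ⬝ᵥ M *ᵥ ξ) (hA : A ∈ CompletelyPositive (P.cellCone k)) :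
    c * A (Fin.last S) (Fin.last S) ≤ trace (M * A) := by
  have h := CompletelyPositive.trace_mul_nonneg (M := M - c • vecMulVec (eLast S) (eLast S))
    (quad_nonneg_of_cell hP fun ξ hξ => by
      rw [sub_mulVec, dotProduct_sub, smul_mulVec, dotProduct_smul, quad_eLast, hξ.1.2]
      simpa using hM ξ hξ) hA
  rw [sub_mul, trace_sub, smul_mul, trace_smul, trace_mul_comm (vecMulVec _ _),
    trace_mul_vecMulVec, mass_eq, smul_eq_mul] at h
  linarith

theorem convex_cp (k : Fin K) : Convex ℝ (CompletelyPositive (P.cellCone k)) := by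
  intro A hA B hB a b ha hb _
  exact CompletelyPositive.add_mem (CompletelyPositive.smul_mem smul_mem_cellCone ha hA)
    (CompletelyPositive.smul_mem smul_mem_cellCone hb hB)

/-- Completely positive matrices of bounded last diagonal entry form a compact set. -/
theorem isCompact_cp (hP : P.Standing) (k : Fin K) (R : ℝ) :
    IsCompact {A | A ∈ CompletelyPositive (P.cellCone k) ∧ A (Fin.last S) (Fin.last S) ≤ R} := by
  set base : Set (Mat S) := convexHull ℝ ((fun ξ => vecMulVec ξ ξ) '' P.cell k) with hbase
  have hbc : IsCompact base := isCompact_convexHull_of_finiteDimensional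
    ((isCompact_cell hP k).image (continuous_id.matrix_vecMulVec continuous_id))
  have hsub : (fun ξ => vecMulVec ξ ξ) '' P.cell k ⊆ base := subset_convexHull ℝ _
  have hbcp : base ⊆ CompletelyPositive (P.cellCone k) := by
    refine convexHull_min ?_ (convex_cp k)
    rintro _ ⟨ξ, hξ, rfl⟩
    exact CompletelyPositive.vecMulVec_mem (mem_cell_iff.1 hξ).1
  have hb1 : ∀ A ∈ base, A (Fin.last S) (Fin.last S) = 1 := by
    have : Convex ℝ {A : Mat S | A (Fin.last S) (Fin.last S) = 1} := by
      intro A hA B hB a b _ _ hab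
      simp only [Set.mem_ofPred_eq] at hA hB ⊢
      simp [hA, hB, hab]
    refine convexHull_min ?_ this
    rintro _ ⟨ξ, hξ, rfl⟩
    show vecMulVec ξ ξ (Fin.last S) (Fin.last S) = 1
    rw [vecMulVec_apply, hξ.1.2, mul_one]
  have heq : {A | A ∈ CompletelyPositive (P.cellCone k) ∧ A (Fin.last S) (Fin.last S) ≤ R} =
      (fun p : ℝ × Mat S => p.1 • p.2) '' (Set.Icc 0 R ×ˢ base) := by
    apply Set.Subset.antisymm
    · rintro A ⟨⟨m, v, hv, rfl⟩, hR⟩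
      choose a ha ξ hξ hvξ using fun i => exists_smul_cell hP (hv i)
      have hterm : ∀ i, vecMulVec (v i) (v i) = (a i * a i) • vecMulVec (ξ i) (ξ i) := fun i => by
        rw [hvξ i, vecMulVec_smul, smul_vecMulVec, smul_smul]
      have hmass : (∑ i, vecMulVec (v i) (v i)) (Fin.last S) (Fin.last S) = ∑ i, a i * a i := by
        rw [Matrix.sum_apply]
        refine Finset.sum_congr rfl fun i _ => ?_
        rw [hterm, Matrix.smul_apply, vecMulVec_apply, (hξ i).1.2]; simp
      rw [hmass] at hR
      have hnn : 0 ≤ ∑ i, a i * a i := Finset.sum_nonneg fun i _ => mul_self_nonneg _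
      rcases hnn.eq_or_lt with h0 | h0
      -- With zero mass all generators vanish; the matrix is 0 times any base point.
      · obtain ⟨ξ₀, hξ₀⟩ := cell_nonempty hP k
        refine ⟨(0, vecMulVec ξ₀ ξ₀), ⟨⟨le_rfl, hnn.trans hR⟩,
          hsub (Set.mem_image_of_mem _ hξ₀)⟩, ?_⟩
        simp only [zero_smul]
        symm
        refine Finset.sum_eq_zero fun i hi => ?_
        rw [hterm, (Finset.sum_eq_zero_iff_of_nonneg fun i _ => mul_self_nonneg (a i)).1 h0.symm i hi,
          zero_smul]
      · refine ⟨(∑ i, a i * a i, ∑ i, ((a i * a i) / ∑ j, a j * a j) • vecMulVec (ξ i) (ξ i)),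
          ⟨⟨hnn, hR⟩, ?_⟩, ?_⟩
        · change ∑ i, ((a i * a i) / ∑ j, a j * a j) • vecMulVec (ξ i) (ξ i) ∈ base
          refine (convex_convexHull ℝ _).sum_mem (fun i _ => div_nonneg (mul_self_nonneg _) hnn) ?_
            fun i _ => hsub (Set.mem_image_of_mem _ (hξ i))
          rw [← Finset.sum_div, div_self h0.ne']
        · simp only
          rw [Finset.smul_sum]
          refine Finset.sum_congr rfl fun i _ => ?_
          rw [hterm, smul_smul, mul_div_cancel₀ _ h0.ne']
    · rintro _ ⟨⟨t, A⟩, ⟨⟨ht0, htR⟩, hA⟩, rfl⟩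
      refine ⟨CompletelyPositive.smul_mem smul_mem_cellCone ht0 (hbcp hA), ?_⟩
      simp [hb1 A hA, htR]
  rw [heq]
  exact (isCompact_Icc.prod hbc).image (continuous_fst.smul continuous_snd)

theorem omegaHat_mem_cp (P : Data N₁ N₂ S L K N) (k : Fin K) :
    P.omegaHat k ∈ CompletelyPositive (P.cellCone k) := by
  refine CompletelyPositive.smul_mem smul_mem_cellCone (by positivity)
    (CompletelyPositive.sum_mem fun i hi => CompletelyPositive.vecMulVec_mem ?_)
  simp only [sampleIdx, Finset.mem_filter] at hi
  exact (mem_cell_iff.1 hi.2).1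

theorem sampleIdx_card_pos (hP : P.Standing) (k : Fin K) : 0 < ((P.sampleIdx k).card : ℝ) := by
  obtain ⟨i, hi⟩ := hP.sample_cell k
  exact Nat.cast_pos.2 (Finset.card_pos.2 ⟨i, by simp [sampleIdx, hi]⟩)

theorem omegaHat_mass (hP : P.Standing) (k : Fin K) :
    P.omegaHat k (Fin.last S) (Fin.last S) = 1 := by
  rw [omegaHat, Matrix.smul_apply, Matrix.sum_apply, Finset.sum_congr rfl
    (g := fun _ => (1 : ℝ)) fun i _ => by
      rw [vecMulVec_apply, (hP.sample_mem i).2, mul_one], Finset.sum_const, smul_eq_mul,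
      nsmul_eq_mul, mul_one, inv_mul_cancel₀ (sampleIdx_card_pos hP k).ne']

theorem omegaHat_isSymm (P : Data N₁ N₂ S L K N) (k : Fin K) : (P.omegaHat k).IsSymm :=
  CompletelyPositive.isSymm (omegaHat_mem_cp P k)

/-! ### Compactness and growth of the subproblem -/

theorem quad_transpose_mul {m n : Type*} [Fintype m] [Fintype n]
    (Y A : Matrix m n ℝ) (v : n → ℝ) :
    v ⬝ᵥ (Yᵀ * A) *ᵥ v = (A *ᵥ v) ⬝ᵥ (Y *ᵥ v) := by
  rw [← mulVec_mulVec, mulVec_transpose, dotProduct_comm, ← dotProduct_mulVec]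

theorem sum_calW_mul (H : Idx L → Mat S) :
    ∑ ℓ, P.calW ℓ * H ℓ = ∑ ℓ, P.W ℓ * H (Sum.inl ℓ) - P.D * H (Sum.inr 1) := by
  rw [Fintype.sum_sum_type, Fin.sum_univ_two]
  simp [calW, sub_eq_add_neg]

theorem sum_lam_smul (H : Idx L → Mat S) :
    ∑ ℓ, (lam ℓ : ℝ) • H ℓ = H (Sum.inr 0) + H (Sum.inr 1) := by
  rw [Fintype.sum_sum_type, Fin.sum_univ_two]
  simp [lam]

/-- Complete recourse bounds the recourse components of solutions of the homogeneous equation. -/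
theorem exists_recourse_bound (hP : P.Standing) (hc : P.CompleteRecourseLDR) :
    ∃ R : ℝ, 0 ≤ R ∧ ∀ k (H : Idx L → Mat S),
      (∀ ℓ, H ℓ ∈ CompletelyPositive (P.cellCone k)) → ∑ ℓ, P.calW ℓ * H ℓ = 0 →
      ∀ ℓ, H ℓ (Fin.last S) (Fin.last S) ≤ R *
        (H (Sum.inr 0) (Fin.last S) (Fin.last S) + H (Sum.inr 1) (Fin.last S) (Fin.last S)) := by
  obtain ⟨Y, hY⟩ := hc
  have hcont : ∀ A : Matrix (Fin N₂) (Fin (S + 1)) ℝ,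
      Continuous fun ξ : Fin (S + 1) → ℝ => (A *ᵥ ξ) ⬝ᵥ (Y *ᵥ ξ) := fun A => by
    simp only [dotProduct, mulVec]; fun_prop
  have hmin : ∀ ℓ, ∃ c : ℝ, 0 < c ∧ ∀ ξ ∈ P.support, c ≤ (P.W ℓ *ᵥ ξ) ⬝ᵥ (Y *ᵥ ξ) := fun ℓ => by
    obtain ⟨ξ, hξ, hm⟩ := hP.support_compact.exists_isMinOn (support_nonempty hP)
      (hcont (P.W ℓ)).continuousOn
    exact ⟨_, hY ξ hξ ℓ, fun ζ hζ => hm hζ⟩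
  choose c hc0 hc using hmin
  obtain ⟨C, hC⟩ : ∃ C : ℝ, ∀ ξ ∈ P.support, (P.D *ᵥ ξ) ⬝ᵥ (Y *ᵥ ξ) ≤ C := by
    obtain ⟨ξ, hξ, hm⟩ := hP.support_compact.exists_isMaxOn (support_nonempty hP)
      (hcont P.D).continuousOn
    exact ⟨_, fun ζ hζ => hm hζ⟩
  have hRnn : ∀ ℓ, 0 ≤ |C| / c ℓ := fun ℓ => div_nonneg (abs_nonneg _) (hc0 ℓ).le
  have hSnn : 0 ≤ ∑ ℓ, |C| / c ℓ := Finset.sum_nonneg fun ℓ _ => hRnn ℓ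
  -- The summand 1 serves the two indices `inr 0` and `inr 1`; each recourse index needs only `|C| /
  -- c ℓ`.
  refine ⟨1 + ∑ ℓ, |C| / c ℓ, by positivity, fun k H hH hW ℓ => ?_⟩
  have hm := fun ℓ => CompletelyPositive.last_nonneg (hH ℓ)
  have h0 := hm (Sum.inr 0)
  have h1 := hm (Sum.inr 1)
  rcases ℓ with ℓ | j
  · rw [sum_calW_mul, sub_eq_zero] at hW
    -- The equation now reads `∑ ℓ, W ℓ * H (inl ℓ) = D * H (inr 1)`. Paired with `Y`, each term on
    -- the left dominates `c ℓ` times its mass, and the right-hand side is at most `|C|` times the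
    -- mass of `H (inr 1)`.
    have key : ∀ ℓ, c ℓ * H (Sum.inl ℓ) (Fin.last S) (Fin.last S) ≤
        trace (Yᵀ * (P.W ℓ * H (Sum.inl ℓ))) := fun ℓ => by
      rw [← Matrix.mul_assoc]
      refine mul_mass_le_trace hP (fun ξ hξ => ?_) (hH _)
      rw [quad_transpose_mul]
      exact hc ℓ ξ hξ.1
    have hD : trace (Yᵀ * (P.D * H (Sum.inr 1))) ≤ |C| * H (Sum.inr 1) (Fin.last S) (Fin.last S) := by
      have := mul_mass_le_trace hP (M := -(Yᵀ * P.D)) (c := -|C|) (fun ξ hξ => ?_) (hH (Sum.inr 1))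
      · rw [Matrix.neg_mul, trace_neg, Matrix.mul_assoc] at this
        linarith
      · rw [neg_mulVec, dotProduct_neg, quad_transpose_mul]
        exact neg_le_neg ((hC ξ hξ.1).trans (le_abs_self C))
    rw [← hW, Matrix.mul_sum, trace_sum] at hD
    have hle : trace (Yᵀ * (P.W ℓ * H (Sum.inl ℓ))) ≤
        ∑ ℓ, trace (Yᵀ * (P.W ℓ * H (Sum.inl ℓ))) :=
      Finset.single_le_sum (f := fun ℓ => trace (Yᵀ * (P.W ℓ * H (Sum.inl ℓ))))
        (fun ℓ _ => (mul_nonneg (hc0 ℓ).le (hm _)).trans (key ℓ)) (Finset.mem_univ ℓ)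
    have h2 : H (Sum.inl ℓ) (Fin.last S) (Fin.last S) ≤
        |C| / c ℓ * H (Sum.inr 1) (Fin.last S) (Fin.last S) := by
      rw [div_mul_eq_mul_div, le_div_iff₀ (hc0 ℓ)]
      linarith [key ℓ]
    have h3 : |C| / c ℓ ≤ ∑ ℓ, |C| / c ℓ :=
      Finset.single_le_sum (f := fun ℓ => |C| / c ℓ) (fun ℓ _ => hRnn ℓ) (Finset.mem_univ ℓ)
    have h4 := mul_le_mul_of_nonneg_right h3 h1
    nlinarith [mul_nonneg hSnn h0]
  · have h5 : H (Sum.inr j) (Fin.last S) (Fin.last S) ≤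
        H (Sum.inr 0) (Fin.last S) (Fin.last S) + H (Sum.inr 1) (Fin.last S) (Fin.last S) := by
      fin_cases j
      · simpa using h1
      · simpa using h0
    nlinarith [mul_nonneg hSnn (add_nonneg h0 h1)]

/-- The objective of the subproblem as a linear functional. -/
noncomputable def dualLin (P : Data N₁ N₂ S L K N) (x : Fin N₁ → ℝ) (θ : ℝ) : (Idx L → Mat S) →ₗ[ℝ] ℝ where
  toFun := P.dualObj x θ
  map_add' H H' := by
    simp only [dualObj, Pi.add_apply, Matrix.add_mul, trace_add, Finset.sum_add_distrib,
      mass_eq, Matrix.add_apply, mul_add]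
    ring
  map_smul' a H := by
    simp only [dualObj, Pi.smul_apply, Matrix.smul_mul, trace_smul, mass_eq, Matrix.smul_apply,
      smul_eq_mul, RingHom.id_apply, mul_sub, Finset.mul_sum]
    congr 1 <;> exact Finset.sum_congr rfl fun _ _ => by ring

theorem dualLin_apply (x : Fin N₁ → ℝ) (θ : ℝ) (H : Idx L → Mat S) :
    P.dualLin x θ H = P.dualObj x θ H := rfl

theorem continuous_dualObj (x : Fin N₁ → ℝ) (θ : ℝ) : Continuous (P.dualObj x θ) :=
  (P.dualLin x θ).continuous_of_finiteDimensional

/-- The mass of `H (inr 1)` is the rate at which the objective decreases in `θ`. -/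
theorem dualObj_eq_sub (x : Fin N₁ → ℝ) (θ : ℝ) (H : Idx L → Mat S) :
    P.dualObj x θ H = P.dualObj x 0 H - θ * H (Sum.inr 1) (Fin.last S) (Fin.last S) := by
  simp only [dualObj, mass_eq, Fintype.sum_sum_type, Fin.sum_univ_two]
  simp [kap]

/-- Absolute sum of all entries of a family of matrices. -/
noncomputable def entrySum (H : Idx L → Mat S) : ℝ := ∑ ℓ, ∑ i, ∑ j, |H ℓ i j|

theorem entrySum_nonneg (H : Idx L → Mat S) : 0 ≤ entrySum H :=
  Finset.sum_nonneg fun _ _ => Finset.sum_nonneg fun _ _ => Finset.sum_nonneg fun _ _ =>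
    abs_nonneg _

theorem continuous_entrySum : Continuous (entrySum : (Idx L → Mat S) → ℝ) := by
  unfold entrySum
  refine continuous_finsetSum _ fun ℓ _ => continuous_finsetSum _ fun i _ =>
    continuous_finsetSum _ fun j _ => ?_
  exact ((continuous_apply ℓ).matrix_elem i j).abs

theorem abs_trace_mul_le {A M : Mat S} {c : ℝ} (hM : ∀ i j, |M i j| ≤ c) :
    |trace (A * M)| ≤ c * ∑ i, ∑ j, |A i j| := by
  simp only [trace, diag_apply, mul_apply]
  refine (Finset.abs_sum_le_sum_abs _ _).trans ?_
  rw [Finset.mul_sum]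
  refine Finset.sum_le_sum fun i _ => (Finset.abs_sum_le_sum_abs _ _).trans ?_
  rw [Finset.mul_sum]
  refine Finset.sum_le_sum fun j _ => ?_
  rw [abs_mul, mul_comm]
  exact mul_le_mul_of_nonneg_right (hM _ _) (abs_nonneg _)

theorem exists_T_bound (hX : IsCompact P.X) :
    ∃ C : ℝ, 0 ≤ C ∧ ∀ x ∈ P.X, ∀ ℓ i, |P.calT x ℓ i| ≤ C := by
  have hc : Continuous fun x : Fin N₁ → ℝ => fun ℓ : Fin L => P.T ℓ x :=
    continuous_pi fun ℓ => (P.T ℓ).continuous_of_finiteDimensional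
  obtain ⟨C, hC⟩ := (hX.image hc).isBounded.exists_norm_le
  refine ⟨|C|, abs_nonneg C, fun x hx ℓ i => ?_⟩
  rcases ℓ with ℓ | j
  · have h1 := hC _ ⟨x, hx, rfl⟩
    have h2 := (norm_le_pi_norm (fun ℓ : Fin L => P.T ℓ x) ℓ).trans h1
    exact (norm_le_pi_norm (P.T ℓ x) i).trans (h2.trans (le_abs_self C))
  · simp [calT]

/-- As the objective is linear in `H`, this is a Lipschitz estimate in `H`, uniform over `X` and
with explicit growth in `θ`. -/
theorem exists_dualObj_bound (hX : IsCompact P.X) :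
    ∃ C : ℝ, 0 ≤ C ∧ ∀ x ∈ P.X, ∀ θ H, |P.dualObj x θ H| ≤ C * (1 + |θ|) * entrySum H := by
  obtain ⟨C, hC0, hC⟩ := exists_T_bound hX
  refine ⟨C + 1, by positivity, fun x hx θ H => ?_⟩
  have h1 : |(1 / 2) * ∑ ℓ, trace (H ℓ * (vecMulVec (eLast S) (P.calT x ℓ) +
      vecMulVec (P.calT x ℓ) (eLast S)))| ≤ C * entrySum H := by
    rw [abs_mul, entrySum, Finset.mul_sum]
    have : |∑ ℓ, trace (H ℓ * (vecMulVec (eLast S) (P.calT x ℓ) +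
        vecMulVec (P.calT x ℓ) (eLast S)))| ≤ ∑ ℓ, (2 * C) * ∑ i, ∑ j, |H ℓ i j| := by
      refine (Finset.abs_sum_le_sum_abs _ _).trans (Finset.sum_le_sum fun ℓ _ =>
        abs_trace_mul_le fun i j => ?_)
      have he : ∀ i, |eLast S i| ≤ 1 := fun i => by
        by_cases h : i = Fin.last S
        · subst h; simp [eLast]
        · simp [eLast, h]
      rw [Matrix.add_apply, vecMulVec_apply, vecMulVec_apply]
      refine (abs_add_le _ _).trans ?_
      rw [abs_mul, abs_mul]
      have a1 := mul_le_mul (he i) (hC x hx ℓ j) (abs_nonneg _) zero_le_one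
      have a2 := mul_le_mul (hC x hx ℓ i) (he j) (abs_nonneg _) hC0
      linarith
    simp only [mul_assoc, ← Finset.mul_sum] at this ⊢
    rw [abs_of_pos (by norm_num : (0 : ℝ) < 1 / 2)]
    linarith
  have h2 : |∑ ℓ, kap ℓ * θ * (eLast S ⬝ᵥ H ℓ *ᵥ eLast S)| ≤ |θ| * entrySum H := by
    rw [entrySum, Finset.mul_sum]
    refine (Finset.abs_sum_le_sum_abs _ _).trans (Finset.sum_le_sum fun ℓ _ => ?_)
    have hk : |(kap ℓ : ℝ)| ≤ 1 := by
      rcases ℓ with ℓ | j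
      · simp [kap]
      · fin_cases j <;> simp [kap]
    rw [mass_eq, abs_mul, abs_mul]
    have h3 : |H ℓ (Fin.last S) (Fin.last S)| ≤ ∑ i, ∑ j, |H ℓ i j| :=
      (Finset.single_le_sum (f := fun j => |H ℓ (Fin.last S) j|) (fun _ _ => abs_nonneg _)
        (Finset.mem_univ _)).trans (Finset.single_le_sum (f := fun i => ∑ j, |H ℓ i j|)
        (fun _ _ => Finset.sum_nonneg fun _ _ => abs_nonneg _) (Finset.mem_univ _))
    have h4 : |(kap ℓ : ℝ)| * |θ| ≤ 1 * |θ| := mul_le_mul_of_nonneg_right hk (abs_nonneg _)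
    rw [one_mul] at h4
    exact mul_le_mul h4 h3 (abs_nonneg _) (abs_nonneg _)
  have h5 := mul_nonneg (mul_nonneg hC0 (abs_nonneg θ)) (entrySum_nonneg H)
  have h6 := entrySum_nonneg H
  rw [dualObj]
  refine (abs_sub _ _).trans ?_
  nlinarith

/-- The `H`-parts of the feasible points of the subproblem. -/
def subSet (P : Data N₁ N₂ S L K N) (k : Fin K) : Set (Idx L → Mat S) :=
  {H | ∃ G O, P.SubFeasible k G O H}

/-- The equations determine `O` as `H (inr 0) + H (inr 1)` and `G` as `O - omegaHat`; complete
positivity of `O` and the sign conditions on the masses are then automatic. -/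
theorem mem_subSet_iff {k : Fin K} {H : Idx L → Mat S} :
    H ∈ P.subSet k ↔ (∀ ℓ, H ℓ ∈ CompletelyPositive (P.cellCone k)) ∧
      ∑ ℓ, P.calW ℓ * H ℓ = 0 ∧
      H (Sum.inr 0) (Fin.last S) (Fin.last S) + H (Sum.inr 1) (Fin.last S) (Fin.last S) = 1 ∧
      frob (H (Sum.inr 0) + H (Sum.inr 1) - P.omegaHat k) ≤ P.ε k := by
  constructor
  · rintro ⟨G, O, h⟩
    have hO := sub_eq_zero.1 h.eqO
    have hH := sub_eq_zero.1 h.eqH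
    rw [sum_lam_smul] at hH
    refine ⟨h.memH, h.recourse, ?_, ?_⟩
    · rw [← Matrix.add_apply, ← hH, hO, ← mass_eq O]; exact h.mass
    · rw [← hH, add_sub_cancel_left]; exact h.norm_le
  · rintro ⟨h1, h2, h3, h4⟩
    refine ⟨H (Sum.inr 0) + H (Sum.inr 1) - P.omegaHat k, H (Sum.inr 0) + H (Sum.inr 1),
      ⟨h4, h2, ?_, fun ℓ => ?_, ?_, ?_, CompletelyPositive.add_mem (h1 _) (h1 _), h1⟩⟩
    · rw [mass_eq, Matrix.add_apply]; exact h3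
    · rw [mass_eq]; exact CompletelyPositive.last_nonneg (h1 ℓ)
    · abel
    · rw [sum_lam_smul]; abel

/-- The two masses that add up to 1 make the recourse bound the constant `R`, which confines every
`H ℓ` to a compact set; the remaining constraints are closed. -/
theorem isCompact_subSet (hP : P.Standing) (hc : P.CompleteRecourseLDR) (k : Fin K) :
    IsCompact (P.subSet k) := by
  obtain ⟨R, hR0, hR⟩ := exists_recourse_bound hP hc
  have hK := isCompact_univ_pi fun _ : Idx L => isCompact_cp hP k R
  have heq : P.subSet k = (Set.univ.pi fun _ : Idx L =>
      {A | A ∈ CompletelyPositive (P.cellCone k) ∧ A (Fin.last S) (Fin.last S) ≤ R}) ∩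
      ({H | ∑ ℓ, P.calW ℓ * H ℓ = 0} ∩
      ({H | H (Sum.inr 0) (Fin.last S) (Fin.last S) +
        H (Sum.inr 1) (Fin.last S) (Fin.last S) = 1} ∩
      {H | frob (H (Sum.inr 0) + H (Sum.inr 1) - P.omegaHat k) ≤ P.ε k})) := by
    ext H
    rw [mem_subSet_iff]
    constructor
    · rintro ⟨h1, h2, h3, h4⟩
      refine ⟨fun ℓ _ => ⟨h1 ℓ, ?_⟩, h2, h3, h4⟩
      have := hR k H h1 h2 ℓ
      rwa [h3, mul_one] at this
    · rintro ⟨h1, h2, h3, h4⟩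
      exact ⟨fun ℓ => (h1 ℓ trivial).1, h2, h3, h4⟩
  rw [heq]
  have ce : ∀ (ℓ : Idx L) i j, Continuous fun H : Idx L → Mat S => H ℓ i j :=
    fun ℓ i j => (continuous_apply ℓ).matrix_elem i j
  refine hK.inter_right (IsClosed.inter ?_ (IsClosed.inter ?_ ?_))
  · refine isClosed_eq (continuous_finsetSum _ fun ℓ _ => ?_) continuous_const
    exact continuous_const.matrix_mul (continuous_apply ℓ)
  · exact isClosed_eq ((ce _ _ _).add (ce _ _ _)) continuous_const
  · exact isClosed_le (continuous_frob.comp (((continuous_apply (A := fun _ : Idx L => Mat S)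
      (Sum.inr 0)).add (continuous_apply (Sum.inr 1))).sub continuous_const)) continuous_const

/-- All mass goes to the constraint `0 ≤ τ`, whose coefficients `𝒲` and `𝒯` vanish. The point shows
feasibility and, having objective 0, that `Zdual` is nonnegative. -/
theorem single_omegaHat_mem_subSet (hP : P.Standing) (k : Fin K) :
    (Pi.single (Sum.inr 0) (P.omegaHat k) : Idx L → Mat S) ∈ P.subSet k := by
  refine mem_subSet_iff.2 ⟨fun ℓ => ?_, ?_, ?_, ?_⟩
  · by_cases h : ℓ = Sum.inr 0
    · subst h; rw [Pi.single_eq_same]; exact omegaHat_mem_cp P k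
    · rw [Pi.single_eq_of_ne h]; exact CompletelyPositive.zero_mem
  · rw [sum_calW_mul]
    simp
  · simp [omegaHat_mass hP k]
  · simp [frob_zero, hP.eps_nonneg k]

theorem dualObj_single_omegaHat (k : Fin K) (x : Fin N₁ → ℝ) (θ : ℝ) :
    P.dualObj x θ (Pi.single (Sum.inr 0) (P.omegaHat k)) = 0 := by
  simp only [dualObj, Fintype.sum_sum_type, Fin.sum_univ_two]
  simp [calT, kap]

/-- `H (inr 1)` is the empirical moment matrix, and `H (inl ℓ)` weights each sample by its linear
programming multiplier `μ ℓ`; dual feasibility at the samples gives the recourse equation. -/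
theorem exists_mem_subSet_mass_eq_one (hP : P.Standing) (hne : P.X.Nonempty)
    (hexp : P.SufficientlyExpensiveRecourse) (k : Fin K) :
    ∃ H ∈ P.subSet k, H (Sum.inr 1) (Fin.last S) (Fin.last S) = 1 := by
  obtain ⟨x, hx⟩ := hne
  choose μ hμ0 hμ using fun i => hexp x hx _ (hP.sample_mem i)
  let H : Idx L → Mat S := Sum.elim
    (fun ℓ => ((P.sampleIdx k).card : ℝ)⁻¹ •
      ∑ i ∈ P.sampleIdx k, μ i ℓ • vecMulVec (P.sample i) (P.sample i))
    (fun j => if j = 0 then 0 else P.omegaHat k)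
  have h1 : H (Sum.inr 1) = P.omegaHat k := by simp [H]
  have h0 : H (Sum.inr 0) = 0 := by simp [H]
  refine ⟨H, mem_subSet_iff.2 ⟨fun ℓ => ?_, ?_, ?_, ?_⟩, by rw [h1, omegaHat_mass hP]⟩
  · rcases ℓ with ℓ | j
    · refine CompletelyPositive.smul_mem smul_mem_cellCone (by positivity)
        (CompletelyPositive.sum_mem fun i hi => CompletelyPositive.smul_mem smul_mem_cellCone
          (hμ0 i ℓ) (CompletelyPositive.vecMulVec_mem ?_))
      simp only [sampleIdx, Finset.mem_filter] at hi
      exact (mem_cell_iff.1 hi.2).1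
    · fin_cases j
      · exact CompletelyPositive.zero_mem
      · exact omegaHat_mem_cp P k
  · rw [sum_calW_mul, h1, sub_eq_zero]
    simp only [H, Sum.elim_inl, omegaHat, Matrix.mul_smul, Matrix.mul_sum, ← Finset.smul_sum]
    rw [Finset.sum_comm]
    congr 1
    refine Finset.sum_congr rfl fun i _ => ?_
    rw [mul_vecMulVec, ← hμ i]
    ext a b
    simp only [Matrix.sum_apply, Matrix.smul_apply, mul_vecMulVec, vecMulVec_apply,
      Finset.sum_apply, Pi.smul_apply, smul_eq_mul, Finset.sum_mul, mul_assoc]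
  · rw [h0, h1, omegaHat_mass hP]; simp
  · rw [h0, h1]; simp [frob_zero, hP.eps_nonneg k]

theorem IsOptimalityCut.mem_subSet {k : Fin K} {x : Fin N₁ → ℝ} {θ : ℝ} {H : Idx L → Mat S}
    (h : P.IsOptimalityCut k x θ H) : H ∈ P.subSet k := by
  obtain ⟨G, O, h, -⟩ := h
  exact ⟨G, O, h⟩

theorem IsOptimalityCut.le {k : Fin K} {x : Fin N₁ → ℝ} {θ : ℝ} {H : Idx L → Mat S}
    (h : P.IsOptimalityCut k x θ H) {H' : Idx L → Mat S} (h' : H' ∈ P.subSet k) :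
    P.dualObj x θ H' ≤ P.dualObj x θ H := by
  obtain ⟨G, O, -, h⟩ := h
  obtain ⟨G', O', h'⟩ := h'
  exact h _ _ _ h'

theorem dualObj_le_Zdual {k : Fin K} {x : Fin N₁ → ℝ} {θ : ℝ} {H : Idx L → Mat S}
    (h : H ∈ P.subSet k) : (P.dualObj x θ H : EReal) ≤ P.Zdual k x θ := by
  obtain ⟨G, O, h⟩ := h
  exact le_sSup ⟨G, O, H, h, rfl⟩

theorem IsOptimalityCut.Zdual_eq {k : Fin K} {x : Fin N₁ → ℝ} {θ : ℝ} {H : Idx L → Mat S}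
    (h : P.IsOptimalityCut k x θ H) : P.Zdual k x θ = (P.dualObj x θ H : EReal) := by
  refine le_antisymm (sSup_le ?_) (dualObj_le_Zdual h.mem_subSet)
  rintro _ ⟨G', O', H', h', rfl⟩
  exact EReal.coe_le_coe_iff.2 (h.le ⟨G', O', h'⟩)

theorem exists_isOptimalityCut (hP : P.Standing) (hc : P.CompleteRecourseLDR) (k : Fin K)
    (x : Fin N₁ → ℝ) (θ : ℝ) : ∃ H, P.IsOptimalityCut k x θ H := by
  obtain ⟨H, ⟨G, O, h⟩, hm⟩ := (isCompact_subSet hP hc k).exists_isMaxOn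
    ⟨_, single_omegaHat_mem_subSet hP k⟩ (continuous_dualObj (P := P) x θ).continuousOn
  exact ⟨H, G, O, h, fun G' O' H' h' => hm ⟨G', O', h'⟩⟩

theorem Zdual_nonneg (hP : P.Standing) (k : Fin K) (x : Fin N₁ → ℝ) (θ : ℝ) :
    0 ≤ P.Zdual k x θ := by
  have := dualObj_le_Zdual (x := x) (θ := θ) (single_omegaHat_mem_subSet hP k)
  rwa [dualObj_single_omegaHat] at this

/-- Expensive recourse makes the subproblem grow at unit rate as `θ` decreases. -/
theorem exists_le_Zdual (hP : P.Standing) (hX : IsCompact P.X) (hne : P.X.Nonempty)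
    (hexp : P.SufficientlyExpensiveRecourse) :
    ∃ C : ℝ, 0 ≤ C ∧ ∀ k, ∀ x ∈ P.X, ∀ θ : ℝ, ((-C - θ : ℝ) : EReal) ≤ P.Zdual k x θ := by
  obtain ⟨C, hC0, hC⟩ := exists_dualObj_bound hX
  choose H hH h1 using exists_mem_subSet_mass_eq_one hP hne hexp
  have hnn : ∀ k, 0 ≤ C * entrySum (H k) := fun k => mul_nonneg hC0 (entrySum_nonneg _)
  refine ⟨∑ k, C * entrySum (H k), Finset.sum_nonneg fun k _ => hnn k, fun k x hx θ => ?_⟩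
  refine le_trans (EReal.coe_le_coe_iff.2 ?_) (dualObj_le_Zdual (hH k))
  rw [dualObj_eq_sub, h1, mul_one]
  have h2 := hC x hx 0 (H k)
  rw [abs_zero, add_zero, mul_one] at h2
  have h3 := Finset.single_le_sum (f := fun k => C * entrySum (H k)) (fun k _ => hnn k)
    (Finset.mem_univ k)
  have h4 := (abs_le.1 h2).1
  linarith

/-! ### Weak and strong duality -/

theorem trace_transpose_mul_of_isSymm {Q H : Mat S} (hH : H.IsSymm) : trace (Qᵀ * H) = trace (Q * H) := by
  rw [← trace_transpose, transpose_mul, transpose_transpose, hH.eq, trace_mul_comm]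

theorem trace_DeltaMat_mul (x : Fin N₁ → ℝ) (Y : Matrix (Fin N₂) (Fin (S + 1)) ℝ) (Q : Mat S)
    (ℓ : Idx L) {H : Mat S} (hH : H.IsSymm) :
    trace (P.DeltaMat x Y Q ℓ * H) = trace (Yᵀ * (P.calW ℓ * H)) + lam ℓ * trace (Q * H) -
      (1 / 2) * trace (H * (vecMulVec (eLast S) (P.calT x ℓ) +
        vecMulVec (P.calT x ℓ) (eLast S))) := by
  have h1 : trace ((P.calW ℓ)ᵀ * Y * H) = trace (Yᵀ * P.calW ℓ * H) := by
    rw [← trace_transpose_mul_of_isSymm hH, transpose_mul, transpose_transpose]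
  rw [Matrix.mul_assoc, Matrix.mul_assoc] at h1
  rw [trace_mul_comm H, DeltaMat, smul_mul, trace_smul, smul_eq_mul]
  simp only [Matrix.sub_mul, Matrix.add_mul, trace_sub, trace_add, Matrix.smul_mul, trace_smul,
    smul_eq_mul, h1, trace_transpose_mul_of_isSymm hH, Matrix.mul_assoc]
  ring

theorem quad_DeltaMat (x : Fin N₁ → ℝ) (Y : Matrix (Fin N₂) (Fin (S + 1)) ℝ) (Q : Mat S)
    (ℓ : Idx L) (v : Fin (S + 1) → ℝ) :
    v ⬝ᵥ P.DeltaMat x Y Q ℓ *ᵥ v = trace (Yᵀ * (P.calW ℓ * vecMulVec v v)) +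
      lam ℓ * trace (Q * vecMulVec v v) -
      (1 / 2) * trace (vecMulVec v v * (vecMulVec (eLast S) (P.calT x ℓ) +
        vecMulVec (P.calT x ℓ) (eLast S))) := by
  rw [← trace_mul_vecMulVec, trace_DeltaMat_mul x Y Q ℓ (by rw [IsSymm, transpose_vecMulVec])]

theorem isSymm_DeltaMat (x : Fin N₁ → ℝ) (Y : Matrix (Fin N₂) (Fin (S + 1)) ℝ) (Q : Mat S)
    (ℓ : Idx L) : (P.DeltaMat x Y Q ℓ).IsSymm := by
  rw [IsSymm, DeltaMat, transpose_smul]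
  congr 1
  simp only [transpose_sub, transpose_add, transpose_mul, transpose_transpose, transpose_smul,
    transpose_vecMulVec]
  abel

theorem isSymm_eLast : (vecMulVec (eLast S) (eLast S)).IsSymm := by
  rw [IsSymm, transpose_vecMulVec]

/-- Weak duality between the copositive program and the completely positive subproblem. -/
theorem Zdual_le_Zprimal (k : Fin K) (x : Fin N₁ → ℝ) (θ : ℝ) :
    P.Zdual k x θ ≤ P.Zprimal k x θ := by
  refine sSup_le ?_
  rintro _ ⟨G, O, H, h, rfl⟩
  refine le_sInf ?_
  rintro _ ⟨Y, Q, B, α, q, hB, hq, hΔ, hBα, rfl⟩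
  rw [EReal.coe_le_coe_iff]
  have hO := sub_eq_zero.1 h.eqO
  have hH := sub_eq_zero.1 h.eqH
  have h1 : ∀ ℓ, 0 ≤ trace (Yᵀ * (P.calW ℓ * H ℓ)) + lam ℓ * trace (Q * H ℓ) -
      (1 / 2) * trace (H ℓ * (vecMulVec (eLast S) (P.calT x ℓ) +
        vecMulVec (P.calT x ℓ) (eLast S))) +
        kap ℓ * θ * (eLast S ⬝ᵥ H ℓ *ᵥ eLast S) := fun ℓ => by
    have a := CompletelyPositive.trace_mul_nonneg (hΔ ℓ).2 (h.memH ℓ)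
    rw [sub_mul, trace_sub, trace_DeltaMat_mul x Y Q ℓ (CompletelyPositive.isSymm (h.memH ℓ)),
      smul_mul, trace_smul, trace_mul_comm (vecMulVec _ _), trace_mul_vecMulVec,
      smul_eq_mul] at a
    nlinarith [mul_nonneg (hq ℓ) (h.last_nonneg ℓ)]
  have h2 := Finset.sum_nonneg fun ℓ (_ : ℓ ∈ Finset.univ) => h1 ℓ
  rw [Finset.sum_add_distrib, Finset.sum_sub_distrib, Finset.sum_add_distrib, ← trace_sum,
    ← Matrix.mul_sum, h.recourse, Matrix.mul_zero, trace_zero, ← Finset.mul_sum] at h2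
  have h3 : ∑ ℓ, (lam ℓ : ℝ) * trace (Q * H ℓ) = trace (Q * (P.omegaHat k + G)) := by
    rw [hH, Matrix.mul_sum, trace_sum]
    exact Finset.sum_congr rfl fun ℓ _ => by rw [Matrix.mul_smul, trace_smul, smul_eq_mul]
  have h4 := CompletelyPositive.trace_mul_nonneg hBα.2 h.memO
  rw [Matrix.add_mul, trace_add, Matrix.smul_mul, trace_smul, trace_mul_comm (vecMulVec _ _),
    trace_mul_vecMulVec, h.mass, ← hO, Matrix.mul_add, trace_add, smul_eq_mul, mul_one] at h4
  rw [h3, Matrix.mul_add, trace_add] at h2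
  have h5 := trace_mul_le_frob (Q + B) G
  rw [Matrix.add_mul, trace_add, transpose_add, hB.eq] at h5
  have h6 := mul_le_mul_of_nonneg_left h.norm_le (frob_nonneg (Qᵀ + B))
  rw [dualObj]
  linarith

/-- Residuals of the homogenized constraints of the subproblem, and its objective relative to
the level `M`. -/
noncomputable def residual (P : Data N₁ N₂ S L K N) (k : Fin K) (x : Fin N₁ → ℝ) (θ M : ℝ) :
    ℝ × Mat S × (Idx L → Mat S) →ₗ[ℝ] (Matrix (Fin N₂) (Fin (S + 1)) ℝ × Mat S × ℝ) × ℝ where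
  toFun z := ((∑ ℓ, P.calW ℓ * z.2.2 ℓ,
    z.1 • P.omegaHat k + z.2.1 - (z.2.2 (Sum.inr 0) + z.2.2 (Sum.inr 1)),
    z.2.2 (Sum.inr 0) (Fin.last S) (Fin.last S) + z.2.2 (Sum.inr 1) (Fin.last S) (Fin.last S)
      - z.1), P.dualLin x θ z.2.2 - z.1 * M)
  map_add' z w := by
    refine Prod.ext (Prod.ext ?_ (Prod.ext ?_ ?_)) ?_
    · simp [Matrix.mul_add, Finset.sum_add_distrib]
    · simp only [Prod.fst_add, Prod.snd_add, Pi.add_apply, add_smul]; abel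
    · simp only [Prod.fst_add, Prod.snd_add, Pi.add_apply, Matrix.add_apply]; ring
    · simp only [Prod.fst_add, Prod.snd_add, map_add]; ring
  map_smul' a z := by
    refine Prod.ext (Prod.ext ?_ (Prod.ext ?_ ?_)) ?_
    · simp [Matrix.mul_smul, Finset.smul_sum]
    · simp [smul_sub, smul_add, smul_smul]
    · simp only [Prod.smul_fst, Prod.smul_snd, Pi.smul_apply, Matrix.smul_apply, smul_eq_mul,
        RingHom.id_apply]; ring
    · simp only [Prod.smul_fst, Prod.smul_snd, map_smul, smul_eq_mul, RingHom.id_apply]; ring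

/-- A compact convex base of the homogenized cone of the subproblem. -/
def coneBase (P : Data N₁ N₂ S L K N) (k : Fin K) : Set (ℝ × Mat S × (Idx L → Mat S)) :=
  {z | 0 ≤ z.1 ∧ frob z.2.1 ≤ z.1 * P.ε k ∧
    (∀ ℓ, z.2.2 ℓ ∈ CompletelyPositive (P.cellCone k)) ∧
    z.1 + ∑ ℓ, z.2.2 ℓ (Fin.last S) (Fin.last S) = 1}

theorem convex_coneBase (k : Fin K) : Convex ℝ (P.coneBase k) := by
  intro z hz w hw a b ha hb hab
  refine ⟨?_, ?_, fun ℓ => ?_, ?_⟩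
  · exact add_nonneg (mul_nonneg ha hz.1) (mul_nonneg hb hw.1)
  · refine (frob_add_le _ _).trans ?_
    simp only [Prod.smul_snd, Prod.smul_fst, Prod.fst_add, frob_smul, abs_of_nonneg ha,
      abs_of_nonneg hb, smul_eq_mul]
    have h1 := mul_le_mul_of_nonneg_left hz.2.1 ha
    have h2 := mul_le_mul_of_nonneg_left hw.2.1 hb
    linarith
  · exact convex_cp k (hz.2.2.1 ℓ) (hw.2.2.1 ℓ) ha hb hab
  · have h1 := hz.2.2.2
    have h2 := hw.2.2.2
    simp only [Prod.smul_snd, Prod.smul_fst, Prod.fst_add, Prod.snd_add, smul_eq_mul,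
      Pi.add_apply, Pi.smul_apply, Matrix.add_apply, Matrix.smul_apply, Finset.sum_add_distrib,
      ← Finset.mul_sum]
    linear_combination a * h1 + b * h2 + hab

theorem isCompact_coneBase (hP : P.Standing) (k : Fin K) : IsCompact (P.coneBase k) := by
  have hK := (isCompact_Icc (a := (0 : ℝ)) (b := 1)).prod ((isCompact_frob_le (S := S) (P.ε k)).prod
    (isCompact_univ_pi fun _ : Idx L => isCompact_cp hP k 1))
  have heq : P.coneBase k = (Set.Icc (0 : ℝ) 1 ×ˢ ({G : Mat S | frob G ≤ P.ε k} ×ˢ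
      (Set.univ.pi fun _ : Idx L => {A | A ∈ CompletelyPositive (P.cellCone k) ∧
        A (Fin.last S) (Fin.last S) ≤ 1}))) ∩
      ({z | frob z.2.1 ≤ z.1 * P.ε k} ∩
        {z | z.1 + ∑ ℓ, z.2.2 ℓ (Fin.last S) (Fin.last S) = 1}) := by
    ext z
    constructor
    · rintro ⟨h1, h2, h3, h4⟩
      have hm : ∀ ℓ, 0 ≤ z.2.2 ℓ (Fin.last S) (Fin.last S) := fun ℓ =>
        CompletelyPositive.last_nonneg (h3 ℓ)
      have hs := Finset.sum_nonneg fun ℓ (_ : ℓ ∈ Finset.univ) => hm ℓ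
      have hz1 : z.1 ≤ 1 := by linarith
      refine ⟨⟨⟨h1, hz1⟩, h2.trans (mul_le_of_le_one_left (hP.eps_nonneg k) hz1),
        fun ℓ _ => ⟨h3 ℓ, ?_⟩⟩, h2, h4⟩
      have := Finset.single_le_sum (f := fun ℓ => z.2.2 ℓ (Fin.last S) (Fin.last S))
        (fun ℓ _ => hm ℓ) (Finset.mem_univ ℓ)
      change z.2.2 ℓ (Fin.last S) (Fin.last S) ≤ 1
      linarith
    · rintro ⟨⟨⟨h1, -⟩, -, h3⟩, h2, h4⟩
      exact ⟨h1, h2, fun ℓ => (h3 ℓ trivial).1, h4⟩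
  rw [heq]
  refine hK.inter_right (IsClosed.inter ?_ ?_)
  · exact isClosed_le (continuous_frob.comp (continuous_fst.comp continuous_snd))
      (continuous_fst.mul continuous_const)
  · refine isClosed_eq (continuous_fst.add (continuous_finsetSum _ fun ℓ _ => ?_))
      continuous_const
    exact (((continuous_apply ℓ).comp (continuous_snd.comp continuous_snd))).matrix_elem _ _

/-- If the homogenizing variable is 0, the recourse bound annihilates all masses, contrary to the
normalization of the base. Otherwise division by it gives a feasible point of the subproblem, whose
objective is below `M`. -/
theorem residual_snd_neg (hP : P.Standing) (hc : P.CompleteRecourseLDR) {k : Fin K}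
    {x : Fin N₁ → ℝ} {θ M : ℝ} (hM : P.Zdual k x θ < (M : EReal))
    {z : ℝ × Mat S × (Idx L → Mat S)} (hz : z ∈ P.coneBase k)
    (h0 : (P.residual k x θ M z).1 = 0) : (P.residual k x θ M z).2 < 0 := by
  obtain ⟨t, G, H⟩ := z
  obtain ⟨ht, hG, hH, hN⟩ := hz
  have e1 : ∑ ℓ, P.calW ℓ * H ℓ = 0 := congrArg (fun p => p.1) h0
  have e2 : t • P.omegaHat k + G - (H (Sum.inr 0) + H (Sum.inr 1)) = 0 :=
    congrArg (fun p => p.2.1) h0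
  have e3 : H (Sum.inr 0) (Fin.last S) (Fin.last S) +
    H (Sum.inr 1) (Fin.last S) (Fin.last S) - t = 0 := congrArg (fun p => p.2.2) h0
  change P.dualLin x θ H - t * M < 0
  simp only at ht hG hH hN
  obtain ⟨R, hR0, hR⟩ := exists_recourse_bound hP hc
  rcases ht.eq_or_lt with h | h
  · exfalso
    subst h
    have : ∑ ℓ, H ℓ (Fin.last S) (Fin.last S) = 0 := by
      refine Finset.sum_eq_zero fun ℓ _ => le_antisymm ?_ (CompletelyPositive.last_nonneg (hH ℓ))
      have := hR k H hH e1 ℓ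
      rwa [sub_eq_zero.1 e3, mul_zero] at this
    linarith
  · have hmem : t⁻¹ • H ∈ P.subSet k := by
      refine mem_subSet_iff.2 ⟨fun ℓ => CompletelyPositive.smul_mem smul_mem_cellCone
        (by positivity) (hH ℓ), ?_, ?_, ?_⟩
      · simp only [Pi.smul_apply, Matrix.mul_smul, ← Finset.smul_sum, e1, smul_zero]
      · simp only [Pi.smul_apply, Matrix.smul_apply, smul_eq_mul, ← mul_add, sub_eq_zero.1 e3]
        exact inv_mul_cancel₀ h.ne'
      · have : (t⁻¹ • H) (Sum.inr 0) + (t⁻¹ • H) (Sum.inr 1) - P.omegaHat k = t⁻¹ • G := by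
          rw [Pi.smul_apply, Pi.smul_apply, ← smul_add, ← sub_eq_zero.1 e2, smul_add, smul_smul,
            inv_mul_cancel₀ h.ne', one_smul, add_sub_cancel_left]
        rw [this, frob_smul, abs_of_pos (by positivity), inv_mul_le_iff₀ h]
        exact hG
    have h1 := (dualObj_le_Zdual (x := x) (θ := θ) hmem).trans_lt hM
    rw [EReal.coe_lt_coe_iff, ← dualLin_apply, map_smul, smul_eq_mul, inv_mul_lt_iff₀ h] at h1
    linarith

theorem exists_residual_separation (hP : P.Standing) (hc : P.CompleteRecourseLDR) {k : Fin K}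
    {x : Fin N₁ → ℝ} {θ M : ℝ} (hM : P.Zdual k x θ < (M : EReal)) :
    ∃ (Y : Matrix (Fin N₂) (Fin (S + 1)) ℝ) (Q : Mat S) (α : ℝ), ∀ z ∈ P.coneBase k,
      trace (Yᵀ * (P.residual k x θ M z).1.1) + trace (Qᵀ * (P.residual k x θ M z).1.2.1) +
        α * (P.residual k x θ M z).1.2.2 + (P.residual k x θ M z).2 < 0 := by
  have : LocallyConvexSpace ℝ (Mat S) :=
    inferInstanceAs (LocallyConvexSpace ℝ (Fin (S + 1) → Fin (S + 1) → ℝ))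
  have : LocallyConvexSpace ℝ (Matrix (Fin N₂) (Fin (S + 1)) ℝ) :=
    inferInstanceAs (LocallyConvexSpace ℝ (Fin N₂ → Fin (S + 1) → ℝ))
  set A := P.residual k x θ M
  -- The image of the base is compact and convex and misses this closed ray, so strict separation
  -- applies without any closedness argument for the image of the full cone.
  set ray : Set ((Matrix (Fin N₂) (Fin (S + 1)) ℝ × Mat S × ℝ) × ℝ) := {p | p.1 = 0 ∧ 0 ≤ p.2}
  have hray : Convex ℝ ray := by
    rintro p ⟨hp1, hp2⟩ q ⟨hq1, hq2⟩ a b ha hb _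
    exact ⟨by simp [hp1, hq1], add_nonneg (mul_nonneg ha hp2) (mul_nonneg hb hq2)⟩
  have hrayc : IsClosed ray := (isClosed_eq continuous_fst continuous_const).inter
    (isClosed_le continuous_const continuous_snd)
  have hdisj : Disjoint (A '' P.coneBase k) ray := by
    rw [Set.disjoint_left]
    rintro _ ⟨z, hz, rfl⟩ ⟨h1, h2⟩
    exact absurd (residual_snd_neg hP hc hM hz h1) (not_lt.2 h2)
  obtain ⟨f, u, v, hu, huv, hv⟩ := geometric_hahn_banach_compact_closed
    ((convex_coneBase k).linear_image A)
    ((isCompact_coneBase hP k).image A.continuous_of_finiteDimensional) hray hrayc hdisj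
  have hv0 : v < 0 := by simpa using hv 0 ⟨rfl, le_rfl⟩
  have hneg : ∀ z ∈ P.coneBase k, f (A z) < 0 := fun z hz =>
    (hu _ ⟨z, hz, rfl⟩).trans (huv.trans hv0)
  obtain ⟨Y, hY⟩ := exists_trace_mul_eq (f.toLinearMap ∘ₗ LinearMap.inl ℝ _ ℝ ∘ₗ
    LinearMap.inl ℝ (Matrix (Fin N₂) (Fin (S + 1)) ℝ) (Mat S × ℝ))
  obtain ⟨Q, hQ⟩ := exists_trace_mul_eq (f.toLinearMap ∘ₗ LinearMap.inl ℝ _ ℝ ∘ₗ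
    LinearMap.inr ℝ (Matrix (Fin N₂) (Fin (S + 1)) ℝ) (Mat S × ℝ) ∘ₗ LinearMap.inl ℝ _ _)
  set α := f ((0, 0, 1), 0)
  set ν := f ((0, 0, 0), 1)
  have hf : ∀ p, f p = trace (Yᵀ * p.1.1) + trace (Qᵀ * p.1.2.1) + α * p.1.2.2 + ν * p.2 := by
    rintro ⟨⟨U, V, a⟩, b⟩
    rw [← hY, ← hQ]
    have : (((U, V, a), b) : (Matrix (Fin N₂) (Fin (S + 1)) ℝ × Mat S × ℝ) × ℝ) =
        ((U, 0, 0), 0) + ((0, V, 0), 0) + a • ((0, 0, 1), 0) + b • ((0, 0, 0), 1) := by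
      simp
    refine (congrArg f this).trans ?_
    rw [map_add, map_add, map_add, map_smul, map_smul, smul_eq_mul, smul_eq_mul,
      mul_comm a, mul_comm b]
    rfl
  -- The point with `omegaHat` in slot `inr 0`, scaled by `1 / 2` into the base, has zero constraint
  -- residual and negative objective residual; negativity of `f` there forces the sign of `ν`, so
  -- `f` can be normalized to `ν = 1`.
  have hν : 0 < ν := by
    have hz : ((1 / 2 : ℝ), (0 : Mat S), (1 / 2 : ℝ) •
        (Pi.single (Sum.inr 0) (P.omegaHat k) : Idx L → Mat S)) ∈ P.coneBase k := by
      refine ⟨by norm_num, ?_, fun ℓ => ?_, ?_⟩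
      · rw [frob_zero]; exact mul_nonneg (by norm_num) (hP.eps_nonneg k)
      · exact CompletelyPositive.smul_mem smul_mem_cellCone (by norm_num)
          ((mem_subSet_iff.1 (single_omegaHat_mem_subSet hP k)).1 ℓ)
      · simp only [Fintype.sum_sum_type, Fin.sum_univ_two]
        simp [omegaHat_mass hP k]
        norm_num
    have hAz1 : (A ((1 / 2 : ℝ), (0 : Mat S), (1 / 2 : ℝ) •
        (Pi.single (Sum.inr 0) (P.omegaHat k) : Idx L → Mat S))).1 = 0 := by
      refine Prod.ext ?_ (Prod.ext ?_ ?_)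
      · change ∑ ℓ, P.calW ℓ * _ = 0
        rw [sum_calW_mul]; simp
      · simp [A, residual]
      · simp [A, residual, omegaHat_mass hP k]
    have h1 := hneg _ hz
    have h2 := residual_snd_neg hP hc hM hz hAz1
    rw [hf, hAz1] at h1
    simp only [Prod.fst_zero, Prod.snd_zero, Matrix.mul_zero, trace_zero, mul_zero, zero_add]
      at h1
    exact pos_of_mul_neg_left h1 h2.le
  refine ⟨ν⁻¹ • Y, ν⁻¹ • Q, ν⁻¹ * α, fun z hz => ?_⟩
  have h1 := hneg z hz
  rw [hf] at h1
  have h2 := mul_neg_of_pos_of_neg (inv_pos.2 hν) h1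
  simp only [transpose_smul, Matrix.smul_mul, trace_smul, smul_eq_mul]
  have h3 : ν⁻¹ * (ν * (A z).2) = (A z).2 := by rw [← mul_assoc, inv_mul_cancel₀ hν.ne', one_mul]
  rw [← h3]
  linarith

/-- Strong duality: Slater's condition for the copositive program follows from complete
recourse. -/
theorem Zprimal_eq_Zdual (hP : P.Standing) (hc : P.CompleteRecourseLDR) (k : Fin K)
    (x : Fin N₁ → ℝ) (θ : ℝ) : P.Zprimal k x θ = P.Zdual k x θ := by
  refine le_antisymm (EReal.le_of_forall_lt_iff_le.1 fun M hM => ?_) (Zdual_le_Zprimal k x θ)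
  obtain ⟨Y, Q, α, hsep⟩ := exists_residual_separation hP hc hM
  -- The multiplier is only tested against symmetric matrices, so its symmetric part suffices.
  obtain ⟨Q', hQs, hQtr⟩ : ∃ Q' : Mat S, Q'.IsSymm ∧
      ∀ H : Mat S, H.IsSymm → trace (Qᵀ * H) = trace (Q' * H) := by
    refine ⟨(1 / 2 : ℝ) • (Q + Qᵀ), ?_, fun H hH => ?_⟩
    · rw [IsSymm, transpose_smul, transpose_add, transpose_transpose, add_comm Q]
    · rw [smul_mul, trace_smul, Matrix.add_mul, trace_add, trace_transpose_mul_of_isSymm hH, smul_eq_mul]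
      ring
  set E : Mat S := vecMulVec (eLast S) (eLast S) with hE
  obtain ⟨G, hGs, hGε, hGtr⟩ := exists_frob_le_trace_eq hQs (hP.eps_nonneg k)
  -- Testing the separation at `t = 1`, `H = 0` and the worst `G` yields the primal cost.
  have hcost : trace (Q' * P.omegaHat k) - α + P.ε k * frob Q' ≤ M := by
    have := hsep (1, G, 0) ⟨zero_le_one, by simpa using hGε,
      fun ℓ => CompletelyPositive.zero_mem, by simp⟩
    simp only [residual, LinearMap.coe_mk, AddHom.coe_mk, Pi.zero_apply, Matrix.mul_zero,
      Finset.sum_const_zero, trace_zero, map_zero, one_smul, add_zero, sub_zero,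
      Matrix.zero_apply, zero_sub, one_mul, zero_add] at this
    rw [hQtr _ (by rw [IsSymm, transpose_add, (omegaHat_isSymm P k).eq, hGs.eq]),
      Matrix.mul_add, trace_add, hGtr] at this
    linarith
  -- Testing at `t = 0`, `G = 0` and the single generator `ξ ξᵀ` in slot `ℓ` yields copositivity of
  -- the `ℓ`-th constraint matrix.
  have hcell : ∀ ℓ, ∀ ξ ∈ P.cell k, 0 ≤ ξ ⬝ᵥ (P.DeltaMat x (-Y) (Q' - α • E) ℓ -
      (-(kap ℓ * θ)) • E) *ᵥ ξ := fun ℓ ξ hξ => by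
    have hξ1 : ξ (Fin.last S) = 1 := hξ.1.2
    have hs := hsep (0, 0, Pi.single ℓ (vecMulVec ξ ξ)) ⟨le_rfl, by simp [frob_zero], fun ℓ' => ?_, ?_⟩
    · rw [sub_mulVec, dotProduct_sub, quad_DeltaMat, smul_mulVec, dotProduct_smul, hE, quad_eLast,
        hξ1]
      have d1 : ∑ ℓ', P.calW ℓ' * (Pi.single ℓ (vecMulVec ξ ξ) : Idx L → Mat S) ℓ' =
          P.calW ℓ * vecMulVec ξ ξ := by
        rw [Finset.sum_eq_single ℓ (fun ℓ' _ h => by rw [Pi.single_eq_of_ne h, Matrix.mul_zero])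
          (fun h => absurd (Finset.mem_univ ℓ) h), Pi.single_eq_same]
      have d2 : (Pi.single ℓ (vecMulVec ξ ξ) : Idx L → Mat S) (Sum.inr 0) +
          (Pi.single ℓ (vecMulVec ξ ξ) : Idx L → Mat S) (Sum.inr 1) =
          (lam ℓ : ℝ) • vecMulVec ξ ξ := by
        rw [← sum_lam_smul, Finset.sum_eq_single ℓ
          (fun ℓ' _ h => by rw [Pi.single_eq_of_ne h, smul_zero])
          (fun h => absurd (Finset.mem_univ ℓ) h), Pi.single_eq_same]
      have d3 : P.dualObj x θ (Pi.single ℓ (vecMulVec ξ ξ)) =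
          (1 / 2) * trace (vecMulVec ξ ξ * (vecMulVec (eLast S) (P.calT x ℓ) +
            vecMulVec (P.calT x ℓ) (eLast S))) - kap ℓ * θ := by
        rw [dualObj, Finset.sum_eq_single ℓ
          (fun ℓ' _ h => by rw [Pi.single_eq_of_ne h, Matrix.zero_mul, trace_zero])
          (fun h => absurd (Finset.mem_univ ℓ) h), Finset.sum_eq_single ℓ
          (fun ℓ' _ h => by rw [Pi.single_eq_of_ne h, mass_eq, Matrix.zero_apply, mul_zero])
          (fun h => absurd (Finset.mem_univ ℓ) h), Pi.single_eq_same, mass_eq, vecMulVec_apply,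
          hξ1, mul_one, mul_one]
      have d4 : (Pi.single ℓ (vecMulVec ξ ξ) : Idx L → Mat S) (Sum.inr 0) (Fin.last S) (Fin.last S) +
          (Pi.single ℓ (vecMulVec ξ ξ) : Idx L → Mat S) (Sum.inr 1) (Fin.last S) (Fin.last S) =
          lam ℓ := by
        rw [← Matrix.add_apply, d2, Matrix.smul_apply, vecMulVec_apply, hξ1]; simp
      simp only [residual, LinearMap.coe_mk, AddHom.coe_mk, zero_smul, zero_add, zero_mul,
        sub_zero, zero_sub, d1, d2, d4, dualLin_apply, d3, Matrix.mul_neg, trace_neg,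
        Matrix.mul_smul, trace_smul, smul_eq_mul] at hs
      rw [hQtr _ (by rw [IsSymm, transpose_vecMulVec])] at hs
      rw [transpose_neg, Matrix.neg_mul, trace_neg, Matrix.sub_mul, trace_sub, Matrix.smul_mul,
        trace_smul, trace_mul_vecMulVec (vecMulVec (eLast S) (eLast S)), quad_eLast, hξ1,
        smul_eq_mul, smul_eq_mul]
      linarith
    · by_cases h : ℓ' = ℓ
      · subst h
        simp only [Pi.single_eq_same]
        exact CompletelyPositive.vecMulVec_mem (mem_cell_iff.1 hξ).1
      · simp only [Pi.single_eq_of_ne h]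
        exact CompletelyPositive.zero_mem
    · simp only [zero_add]
      rw [Finset.sum_eq_single ℓ
          (fun ℓ' _ h => by rw [Pi.single_eq_of_ne h, Matrix.zero_apply])
          (fun h => absurd (Finset.mem_univ ℓ) h), Pi.single_eq_same, vecMulVec_apply, hξ1, mul_one]
  have hEs : E.IsSymm := isSymm_eLast
  have hle : P.Zprimal k x θ ≤ ((-α + trace ((Q' - α • E) * P.omegaHat k) +
      trace ((α • E) * P.omegaHat k) + P.ε k * frob ((Q' - α • E)ᵀ + α • E) : ℝ) : EReal) := by
    -- Putting `α • E` into `B` and removing it from `Q` makes `B` plus the multiple `-α` of `E`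
    -- vanish, while `Qᵀ + B` stays equal to `Q'`.
    refine sInf_le ⟨-Y, Q' - α • E, α • E, -α, fun ℓ => -(kap ℓ * θ), ?_, fun ℓ => ?_,
      fun ℓ => ⟨?_, quad_nonneg_of_cell hP (hcell ℓ)⟩, ?_, rfl⟩
    · rw [IsSymm, transpose_smul, hEs.eq]
    · simp
    · rw [IsSymm, transpose_sub, (isSymm_DeltaMat x _ _ ℓ).eq, transpose_smul, hEs.eq]
    · rw [← hE, ← add_smul, add_neg_cancel, zero_smul]
      exact ⟨by simp [IsSymm], fun v _ => by simp⟩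
  refine hle.trans (EReal.coe_le_coe_iff.2 ?_)
  rw [transpose_sub, hQs.eq, transpose_smul, hEs.eq, sub_add_cancel, Matrix.sub_mul, trace_sub]
  linarith

end Data

/-! ### Conic constraints of the master problem -/

theorem MasterPoint.ConicFeasible.two_mul_r_le {N₁ K : ℕ} {z : MasterPoint N₁ K}
    (h : z.ConicFeasible) (k : Fin K) : z.s k + z.eta ≤ 2 * z.ω - 2 * z.r k := by
  have h1 : 2 * z.r k ≤ Real.sqrt (4 * z.r k ^ 2 + (z.s k + z.eta) ^ 2) := by
    refine (le_abs_self _).trans (Real.abs_le_sqrt ?_)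
    nlinarith [sq_nonneg (z.s k + z.eta)]
  linarith [(h.2 k).2]

/-- Raising all `s k` and lowering `eta` by the same amount. -/
def MasterPoint.shift {N₁ K : ℕ} (z : MasterPoint N₁ K) (d : ℝ) : MasterPoint N₁ K :=
  { z with s := fun k => z.s k + d, eta := z.eta - d }

theorem MasterPoint.ConicFeasible.shift {N₁ K : ℕ} {z : MasterPoint N₁ K}
    (h : z.ConicFeasible) (d : ℝ) : (z.shift d).ConicFeasible := by
  refine ⟨h.1, fun k => ?_⟩
  have e : z.s k + d + (z.eta - d) = z.s k + z.eta := by ring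
  have e' : 2 * z.ω - (z.s k + d) - (z.eta - d) = 2 * z.ω - z.s k - z.eta := by ring
  simp only [MasterPoint.shift, e, e']
  exact h.2 k

theorem exists_conicFeasible {N₁ K : ℕ} (x : Fin N₁ → ℝ) (θ : ℝ) (s : Fin K → ℝ) :
    ∃ z : MasterPoint N₁ K, z.x = x ∧ z.θ = θ ∧ z.s = s ∧ z.ConicFeasible := by
  -- With `eta = 0` and `r = 0` both constraints follow from `|s k| ≤ ω`.
  refine ⟨⟨x, θ, 0, ∑ k, |s k|, 0, s⟩, rfl, rfl, rfl,
    Finset.sum_nonneg fun k _ => abs_nonneg _, fun k => ?_⟩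
  have h := Finset.single_le_sum (f := fun k => |s k|) (fun k _ => abs_nonneg _)
    (Finset.mem_univ k)
  simp only [Pi.zero_apply, add_zero, sub_zero]
  have h2 := le_abs_self (s k)
  refine ⟨h2.trans h, ?_⟩
  rw [show 4 * (0 : ℝ) ^ 2 + s k ^ 2 = s k ^ 2 by ring, Real.sqrt_sq_eq_abs]
  linarith

/-! ### Coercivity and finiteness of the optimal value -/

namespace Data

variable {N₁ N₂ S L K N : ℕ} {P : Data N₁ N₂ S L K N}

theorem exists_mem_cell (hP : P.Standing) {ξ : Fin (S + 1) → ℝ} (hξ : ξ ∈ P.support) :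
    ∃ k, ξ ∈ P.cell k := by
  have : Nonempty (Fin K) := ⟨⟨0, hP.cells_pos⟩⟩
  obtain ⟨k, hk⟩ := Finite.exists_min fun k => (ξ - P.ctr k) ⬝ᵥ (ξ - P.ctr k)
  exact ⟨k, hξ, fun i _ => hk i⟩

theorem phat_nonneg (P : Data N₁ N₂ S L K N) (k : Fin K) : 0 ≤ P.phat k := by
  unfold phat; positivity

theorem sum_phat (hP : P.Standing) : ∑ k, P.phat k = 1 := by
  classical
  have hN : 0 < (N : ℝ) := by
    obtain ⟨i, -⟩ := hP.sample_cell ⟨0, hP.cells_pos⟩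
    exact Nat.cast_pos.2 (Nat.lt_of_le_of_lt (Nat.zero_le _) i.2)
  have hcard : ∑ k, (P.sampleIdx k).card = N := by
    have hdisj : Set.PairwiseDisjoint (Finset.univ : Finset (Fin K)) P.sampleIdx := by
      intro k _ k' _ hkk'
      refine Finset.disjoint_left.2 fun i hi hi' => hkk' ?_
      simp only [sampleIdx, Finset.mem_filter] at hi hi'
      exact hP.sample_unique i k k' hi.2 hi'.2
    rw [← Finset.card_biUnion hdisj]
    have : (Finset.univ : Finset (Fin K)).biUnion P.sampleIdx = Finset.univ := by
      ext i
      obtain ⟨k, hk⟩ := exists_mem_cell hP (hP.sample_mem i)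
      simp only [Finset.mem_biUnion, Finset.mem_univ, true_and, iff_true]
      exact ⟨k, by simp [sampleIdx, hk]⟩
    rw [this, Finset.card_univ, Fintype.card_fin]
  simp only [phat]
  rw [← Finset.sum_div, ← Nat.cast_sum, hcard, div_self hN.ne']

/-- Average `s k + eta ≤ 2 ω - 2 r k` with the weights `phat`, which sum to 1; `eta` cancels, and `γ
ω ≥ 0` is dropped. -/
theorem le_obj (hP : P.Standing) {z : MasterPoint N₁ K} (hz : z.ConicFeasible) :
    P.c ⬝ᵥ z.x + z.θ + (1 / P.δ) * ∑ k, P.phat k * z.s k ≤ P.obj z := by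
  have h1 : ∑ k, P.phat k * (z.s k + z.eta) ≤ ∑ k, P.phat k * (2 * z.ω - 2 * z.r k) :=
    Finset.sum_le_sum fun k _ => mul_le_mul_of_nonneg_left (hz.two_mul_r_le k) (phat_nonneg P k)
  have h2 : ∑ k, P.phat k * (z.s k + z.eta) = ∑ k, P.phat k * z.s k + z.eta := by
    simp only [mul_add, Finset.sum_add_distrib, ← Finset.sum_mul, sum_phat hP, one_mul]
  have h3 : ∑ k, P.phat k * (2 * z.ω - 2 * z.r k) = 2 * z.ω - 2 * (P.phat ⬝ᵥ z.r) := by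
    simp only [mul_sub, Finset.sum_sub_distrib, ← Finset.sum_mul, sum_phat hP, one_mul,
      dotProduct, Finset.mul_sum]
    congr 1
    exact Finset.sum_congr rfl fun k _ => by ring
  have h4 := mul_nonneg hP.gamma_nonneg hz.1
  rw [obj, sum_phat hP]
  have h5 : 0 < 1 / P.δ := one_div_pos.2 hP.delta_pos
  have := mul_le_mul_of_nonneg_left (a := 1 / P.δ) (b := ∑ k, P.phat k * z.s k)
    (c := P.γ * z.ω - z.eta - 2 * (P.phat ⬝ᵥ z.r) + 2 * z.ω * 1) (by linarith) h5.le
  linarith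

theorem obj_shift (z : MasterPoint N₁ K) (d : ℝ) :
    P.obj (z.shift d) = P.obj z + d / P.δ := by
  simp only [obj, MasterPoint.shift]
  ring

/-- Under expensive recourse the objective is coercive in `θ`. -/
theorem exists_coercive (hP : P.Standing) (hX : IsCompact P.X) (hne : P.X.Nonempty)
    (hexp : P.SufficientlyExpensiveRecourse) :
    ∃ a C : ℝ, 0 < a ∧ 0 ≤ C ∧ ∀ z : MasterPoint N₁ K, z.x ∈ P.X → z.ConicFeasible →
      (∀ k, P.Zdual k z.x z.θ ≤ (z.s k : EReal)) → a * |z.θ| - C ≤ P.obj z := by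
  obtain ⟨C, hC0, hC⟩ := exists_le_Zdual hP hX hne hexp
  obtain ⟨x₀, -, hx₀⟩ := hX.exists_isMinOn hne (f := fun x => P.c ⬝ᵥ x) (by
    simp only [dotProduct]; fun_prop)
  have hd := hP.delta_pos
  have h1d : 1 < 1 / P.δ := (one_lt_div hd).2 hP.delta_lt_one
  -- The slope is 1 for `θ ≥ 0`, from `Z_k ≥ 0`, and `1 / δ - 1` for `θ ≤ 0`, from `Z_k ≥ -C - θ`.
  refine ⟨min 1 (1 / P.δ - 1), |P.c ⬝ᵥ x₀| + 1 / P.δ * C, lt_min one_pos (by linarith),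
    by positivity, fun z hzX hz hs => ?_⟩
  have h1 := le_obj hP hz
  have h2 : P.c ⬝ᵥ x₀ ≤ P.c ⬝ᵥ z.x := hx₀ hzX
  have h3 := neg_abs_le (P.c ⬝ᵥ x₀)
  have hlow : ∀ b : ℝ, (∀ k, (b : EReal) ≤ P.Zdual k z.x z.θ) →
      b ≤ ∑ k, P.phat k * z.s k := fun b hb => by
    have : ∑ k, P.phat k * b ≤ ∑ k, P.phat k * z.s k := Finset.sum_le_sum fun k _ =>
      mul_le_mul_of_nonneg_left (EReal.coe_le_coe_iff.1 ((hb k).trans (hs k))) (phat_nonneg P k)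
    rwa [← Finset.sum_mul, sum_phat hP, one_mul] at this
  have h4 := hlow 0 fun k => Zdual_nonneg hP k _ _
  have h5 := hlow (-C - z.θ) fun k => hC k _ hzX _
  have h6 : 0 ≤ 1 / P.δ * C := by positivity
  rcases le_total 0 z.θ with h | h
  · rw [abs_of_nonneg h]
    have h7 := mul_le_mul_of_nonneg_right (min_le_left 1 (1 / P.δ - 1)) h
    have h8 := mul_nonneg (by linarith : 0 ≤ 1 / P.δ) h4
    linarith
  · rw [abs_of_nonpos h]
    have h7 := mul_le_mul_of_nonneg_right (min_le_right 1 (1 / P.δ - 1)) (neg_nonneg.2 h)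
    have h8 := mul_le_mul_of_nonneg_left h5 (by linarith : 0 ≤ 1 / P.δ)
    linarith

theorem exists_Zdual_eq_coe (hP : P.Standing) (hc : P.CompleteRecourseLDR) (k : Fin K)
    (x : Fin N₁ → ℝ) (θ : ℝ) : ∃ r : ℝ, P.Zdual k x θ = (r : EReal) := by
  obtain ⟨H, hH⟩ := exists_isOptimalityCut hP hc k x θ
  exact ⟨_, hH.Zdual_eq⟩

theorem exists_feasible_of_Zdual (hP : P.Standing) (hc : P.CompleteRecourseLDR)
    (x : Fin N₁ → ℝ) (θ : ℝ) : ∃ z : MasterPoint N₁ K, z.x = x ∧ z.θ = θ ∧ z.ConicFeasible ∧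
      ∀ k, P.Zdual k z.x z.θ ≤ (z.s k : EReal) := by
  choose s hs using fun k => exists_Zdual_eq_coe hP hc k x θ
  obtain ⟨z, rfl, rfl, rfl, hz⟩ := exists_conicFeasible x θ s
  exact ⟨z, rfl, rfl, hz, fun k => (hs k).le⟩

theorem pdrValue_eq_candidate (hP : P.Standing) (hc : P.CompleteRecourseLDR)
    (z : MasterPoint N₁ K) : P.pdrValue z.x z.θ = P.candidate z := by
  simp only [pdrValue, candidate, Zprimal_eq_Zdual hP hc]

theorem pdrValue_lt_top (hP : P.Standing) (hc : P.CompleteRecourseLDR)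
    (x : Fin N₁ → ℝ) (θ : ℝ) : P.pdrValue x θ < ⊤ := by
  obtain ⟨z, hx, hθ, hz, hs⟩ := exists_feasible_of_Zdual hP hc x θ
  refine lt_of_le_of_lt (sInf_le ⟨z, hx, hθ, hz, fun k => ?_, rfl⟩) (EReal.coe_lt_top _)
  simp only [Zprimal_eq_Zdual hP hc]
  rw [← hx, ← hθ]
  exact hs k

theorem JPDR_le_pdrValue {x : Fin N₁ → ℝ} (hx : x ∈ P.X) (θ : ℝ) :
    P.JPDR ≤ P.pdrValue x θ := by
  refine sInf_le_sInf ?_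
  rintro _ ⟨z, rfl, rfl, hz, hs, rfl⟩
  exact ⟨z, hx, hz, hs, rfl⟩

theorem exists_JPDR_eq_coe (hP : P.Standing) (hX : IsCompact P.X) (hne : P.X.Nonempty)
    (hc : P.CompleteRecourseLDR) (hexp : P.SufficientlyExpensiveRecourse) :
    ∃ j : ℝ, P.JPDR = (j : EReal) := by
  obtain ⟨a, C, ha, hC, h⟩ := exists_coercive hP hX hne hexp
  obtain ⟨x, hx⟩ := hne
  have h1 : P.JPDR < ⊤ := (JPDR_le_pdrValue hx 0).trans_lt (pdrValue_lt_top hP hc x 0)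
  have h2 : ((-C : ℝ) : EReal) ≤ P.JPDR := by
    refine le_sInf ?_
    rintro _ ⟨z, hzX, hz, hs, rfl⟩
    have := h z hzX hz fun k => by rw [← Zprimal_eq_Zdual hP hc]; exact hs k
    exact EReal.coe_le_coe_iff.2 (by nlinarith [abs_nonneg z.θ])
  exact ⟨P.JPDR.toReal, (EReal.coe_toReal h1.ne
    ((EReal.bot_lt_coe _).trans_le h2).ne').symm⟩

/-! ### Upper bounds, invariants and single iterations -/

/-- The conic constraints see `s` and `eta` only through `s k + eta`, so a shift by `d` repairs the
violation at cost `d / δ`. -/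
theorem candidate_le_of_Zdual_le {z : MasterPoint N₁ K} (hz : z.ConicFeasible) {d : ℝ}
    (h : ∀ k, P.Zdual k z.x z.θ ≤ ((z.s k + d : ℝ) : EReal)) :
    P.candidate z ≤ ((P.obj z + d / P.δ : ℝ) : EReal) := by
  rw [← obj_shift]
  exact sInf_le ⟨z.shift d, rfl, rfl, hz.shift d, h, rfl⟩

/-- Properties shared by all states that runs of the algorithm reach. -/
structure Sound (P : Data N₁ N₂ S L K N) (st : AlgState N₁ S L K) : Prop where
  optCuts : ∀ k, st.V k ⊆ P.subSet k
  feasCuts : ∀ k, st.W k = ∅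
  incumbent : (st.ub = ⊤ ∧ st.inc = none) ∨
    ∃ x θ, x ∈ P.X ∧ st.inc = some (x, θ) ∧ P.pdrValue x θ = st.ub

theorem sound_init : P.Sound (AlgState.init N₁ S L K) :=
  ⟨fun _ => Set.empty_subset _, fun _ => rfl, Or.inl ⟨rfl, rfl⟩⟩

theorem IsMasterOutput.feasible {a : ℝ} {st : AlgState N₁ S L K} {z : MasterPoint N₁ K}
    (h : P.IsMasterOutput a st z) : P.MasterFeasible st z :=
  h.elim (fun h => h.1) fun h => h.2.1

theorem Sound.exists_newInc {st : AlgState N₁ S L K} (h : P.Sound st) (hP : P.Standing)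
    (hc : P.CompleteRecourseLDR) {z : MasterPoint N₁ K} (hz : z.x ∈ P.X) :
    ∃ x θ, x ∈ P.X ∧ P.newInc st z = some (x, θ) ∧ P.pdrValue x θ = P.newUb st z := by
  have hlt := pdrValue_lt_top hP hc z.x z.θ
  rw [pdrValue_eq_candidate hP hc] at hlt
  by_cases hcand : P.candidate z < st.ub
  · exact ⟨z.x, z.θ, hz, by simp [newInc, hcand],
      by rw [newUb, if_pos hcand, pdrValue_eq_candidate hP hc]⟩
  · rcases h.incumbent with ⟨h1, -⟩ | ⟨x, θ, hx, h1, h2⟩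
    · exact absurd (h1 ▸ hlt) hcand
    · exact ⟨x, θ, hx, by rw [newInc, if_neg hcand, h1], by rw [newUb, if_neg hcand, h2]⟩

theorem newUb_le_candidate (st : AlgState N₁ S L K) (z : MasterPoint N₁ K) :
    P.newUb st z ≤ P.candidate z := by
  rw [newUb]
  split_ifs with h
  · exact le_rfl
  · exact not_lt.1 h

/-- Finiteness of `Zdual` rules out the branch that adds a feasibility cut. -/
theorem Updates.cases {st st' : AlgState N₁ S L K} {z : MasterPoint N₁ K} (hP : P.Standing)
    (hc : P.CompleteRecourseLDR) (h : P.Updates st z st') (k : Fin K) :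
    ((z.s k : EReal) < P.Zdual k z.x z.θ ∧ (∃ H, P.IsOptimalityCut k z.x z.θ H ∧
        st'.V k = insert H (st.V k)) ∧ st'.W k = st.W k) ∨
    (P.Zdual k z.x z.θ ≤ (z.s k : EReal) ∧ st'.V k = st.V k ∧ st'.W k = st.W k) := by
  rcases h.2.2 k with ⟨h1, -⟩ | ⟨h1, -, H, h2, h3, h4⟩ | h1
  · obtain ⟨r, hr⟩ := exists_Zdual_eq_coe hP hc k z.x z.θ
    rw [hr] at h1
    exact absurd h1 (EReal.coe_ne_top r)
  · exact Or.inl ⟨h1, ⟨H, h2, h3⟩, h4⟩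
  · exact Or.inr h1

theorem Sound.updates {st st' : AlgState N₁ S L K} (h : P.Sound st) (hP : P.Standing)
    (hc : P.CompleteRecourseLDR) {z : MasterPoint N₁ K} (hz : z.x ∈ P.X)
    (hu : P.Updates st z st') : P.Sound st' := by
  refine ⟨fun k => ?_, fun k => ?_, Or.inr ?_⟩
  · rcases hu.cases hP hc k with ⟨-, ⟨H, h2, h3⟩, -⟩ | ⟨-, h2, -⟩
    · rw [h3]
      exact Set.insert_subset h2.mem_subSet (h.optCuts k)
    · rw [h2]; exact h.optCuts k
  · rcases hu.cases hP hc k with ⟨-, -, h3⟩ | ⟨-, -, h3⟩ <;> rw [h3, h.feasCuts k]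
  · rw [hu.1, hu.2.1]; exact h.exists_newInc hP hc hz

theorem sound_of_reachable (hP : P.Standing) (hc : P.CompleteRecourseLDR) {tol : ℝ}
    {acc : ℕ → ℝ} {t : ℕ} {st : AlgState N₁ S L K} (h : P.Reachable tol acc t st) :
    P.Sound st := by
  induction h with
  | start => exact sound_init
  | step _ hs ih =>
    obtain ⟨z, hz, -, hu⟩ := hs
    exact ih.updates hP hc hz.feasible.mem hu

theorem Sound.masterFeasible {st : AlgState N₁ S L K} (h : P.Sound st) {z : MasterPoint N₁ K}
    (hzX : z.x ∈ P.X) (hz : z.ConicFeasible)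
    (hs : ∀ k, P.Zdual k z.x z.θ ≤ (z.s k : EReal)) : P.MasterFeasible st z := by
  refine ⟨hzX, hz, fun k H hH => ?_, fun k H hH => ?_⟩
  · exact EReal.coe_le_coe_iff.1 ((dualObj_le_Zdual (h.optCuts k hH)).trans (hs k))
  · rw [h.feasCuts k] at hH
    exact absurd hH (Set.notMem_empty H)

/-- Cuts come from feasible points of the subproblem, so weak duality makes the master problem a
relaxation. -/
theorem Sound.masterValue_le_JPDR {st : AlgState N₁ S L K} (h : P.Sound st) :
    P.masterValue st ≤ P.JPDR := by
  refine sInf_le_sInf ?_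
  rintro _ ⟨z, hzX, hz, hs, rfl⟩
  exact ⟨z, h.masterFeasible hzX hz fun k => (Zdual_le_Zprimal k _ _).trans (hs k), rfl⟩

theorem Sound.exists_isMasterOutput {st : AlgState N₁ S L K} (h : P.Sound st)
    (hP : P.Standing) (hc : P.CompleteRecourseLDR) (hne : P.X.Nonempty) {a : ℝ} (ha : 0 < a) :
    ∃ z, P.IsMasterOutput a st z := by
  by_cases hopt : ∃ z, P.IsMasterOptimal st z
  · exact hopt.imp fun z hz => Or.inl hz
  obtain ⟨x, hx⟩ := hne
  obtain ⟨z₀, rfl, -, hz₀, hs₀⟩ := exists_feasible_of_Zdual hP hc x 0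
  have hlt : P.masterValue st < ⊤ :=
    (sInf_le ⟨z₀, h.masterFeasible hx hz₀ hs₀, rfl⟩ : P.masterValue st ≤ _).trans_lt
      (EReal.coe_lt_top _)
  -- The cap at `-(1 / a)` keeps `m` finite, so `m + a` strictly exceeds the infimum even if that is
  -- `⊥`.
  set m := max (P.masterValue st) ((-(1 / a) : ℝ) : EReal)
  have hm : m = (m.toReal : EReal) := (EReal.coe_toReal (max_lt hlt (EReal.coe_lt_top _)).ne
    ((EReal.bot_lt_coe _).trans_le (le_max_right _ _)).ne').symm
  have h1 : P.masterValue st < m + (a : EReal) := by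
    refine (le_max_left _ ((-(1 / a) : ℝ) : EReal)).trans_lt ?_
    change m < m + a
    rw [hm, ← EReal.coe_add, EReal.coe_lt_coe_iff]
    linarith
  obtain ⟨_, ⟨z, hz, rfl⟩, hlt⟩ := sInf_lt_iff.1 h1
  exact ⟨z, Or.inr ⟨hopt, hz, hlt.le⟩⟩

theorem exists_updates (hP : P.Standing) (hc : P.CompleteRecourseLDR) (st : AlgState N₁ S L K)
    (z : MasterPoint N₁ K) : ∃ st', P.Updates st z st' := by
  classical
  choose H hH using fun k => exists_isOptimalityCut hP hc k z.x z.θ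
  refine ⟨⟨fun k => if (z.s k : EReal) < P.Zdual k z.x z.θ then insert (H k) (st.V k) else st.V k,
    st.W, P.newUb st z, P.newInc st z⟩, rfl, rfl, fun k => Or.inr ?_⟩
  by_cases hk : (z.s k : EReal) < P.Zdual k z.x z.θ
  · refine Or.inl ⟨hk, ?_, H k, hH k, by simp [hk], rfl⟩
    rw [(hH k).Zdual_eq]; exact EReal.coe_lt_top _
  · exact Or.inr ⟨not_lt.1 hk, by simp [hk], rfl⟩

/-- The objective value of an output of the master problem in terms of the lower bound. -/
theorem IsMasterOutput.obj_le {a : ℝ} (ha : 0 < a) {st : AlgState N₁ S L K}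
    {z : MasterPoint N₁ K} (h : P.IsMasterOutput a st z) :
    (∃ l : ℝ, P.masterValue st = (l : EReal) ∧ P.obj z ≤ l + a) ∨
      P.obj z ≤ -(1 / a) + a := by
  rcases h with ⟨hz, hm⟩ | ⟨-, hz, hm⟩
  · refine Or.inl ⟨P.obj z, le_antisymm (sInf_le ⟨z, hz, rfl⟩) (le_sInf ?_), by linarith⟩
    rintro _ ⟨z', hz', rfl⟩
    exact EReal.coe_le_coe_iff.2 (hm z' hz')
  · rcases le_total (P.masterValue st) ((-(1 / a) : ℝ) : EReal) with h1 | h1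
    · rw [max_eq_right h1, ← EReal.coe_add, EReal.coe_le_coe_iff] at hm
      exact Or.inr hm
    · have hlt : P.masterValue st < ⊤ :=
        (sInf_le ⟨z, hz, rfl⟩ : P.masterValue st ≤ _).trans_lt (EReal.coe_lt_top _)
      have hl : P.masterValue st = ((P.masterValue st).toReal : EReal) :=
        (EReal.coe_toReal hlt.ne ((EReal.bot_lt_coe _).trans_le h1).ne').symm
      rw [max_eq_left h1, hl, ← EReal.coe_add, EReal.coe_le_coe_iff] at hm
      exact Or.inl ⟨_, hl, hm⟩

/-! ### Accumulation of cuts and termination -/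

theorem entrySum_sub_le (A B C : Idx L → Mat S) :
    entrySum (A - B) ≤ entrySum (A - C) + entrySum (B - C) := by
  simp only [entrySum, ← Finset.sum_add_distrib]
  refine Finset.sum_le_sum fun ℓ _ => Finset.sum_le_sum fun i _ => Finset.sum_le_sum fun j _ => ?_
  simp only [Pi.sub_apply, Matrix.sub_apply]
  rw [abs_sub_comm (B ℓ i j)]
  exact abs_sub_le _ _ _

/-- Along an infinite run, the violation of the subproblem bounds becomes arbitrarily small
relative to `1 + |θ|` arbitrarily late. -/
theorem exists_small_violation (hP : P.Standing) (hX : IsCompact P.X)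
    (hc : P.CompleteRecourseLDR) {st : ℕ → AlgState N₁ S L K} {z : ℕ → MasterPoint N₁ K}
    (hz : ∀ t, P.MasterFeasible (st t) (z t)) (hu : ∀ t, P.Updates (st t) (z t) (st (t + 1)))
    {e : ℝ} (he : 0 < e) (T : ℕ) :
    ∃ t, T ≤ t ∧ ∀ k, P.Zdual k (z t).x (z t).θ ≤
      (((z t).s k + e * (1 + |(z t).θ|) : ℝ) : EReal) := by
  classical
  obtain ⟨C, hC0, hC⟩ := exists_dualObj_bound hX
  have hex : ∀ t k, ∃ H, P.IsOptimalityCut k (z t).x (z t).θ H ∧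
      (((z t).s k : EReal) < P.Zdual k (z t).x (z t).θ → H ∈ (st (t + 1)).V k) := fun t k => by
    rcases (hu t).cases hP hc k with ⟨-, ⟨H, h2, h3⟩, -⟩ | ⟨h1, -⟩
    · exact ⟨H, h2, fun _ => h3 ▸ Set.mem_insert _ _⟩
    · obtain ⟨H, hH⟩ := exists_isOptimalityCut hP hc k (z t).x (z t).θ
      exact ⟨H, hH, fun h => absurd h (not_lt.2 h1)⟩
  choose H hH hHV using hex
  have hmono : ∀ k, Monotone fun t => (st t).V k := fun k =>
    monotone_nat_of_le_succ fun t => by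
      rcases (hu t).cases hP hc k with ⟨-, ⟨H, -, h3⟩, -⟩ | ⟨-, h2, -⟩
      · rw [h3]; exact Set.subset_insert _ _
      · rw [h2]
  -- Recording in `b` which cells are violated, next to the maximizers, lets one convergent
  -- subsequence treat all cells at once: along it, each cell is eventually always or never
  -- violated.
  let b : ℕ → Fin K → ℝ := fun t k =>
    if ((z t).s k : EReal) < P.Zdual k (z t).x (z t).θ then 1 else 0
  have : FirstCountableTopology (Mat S) :=
    inferInstanceAs (FirstCountableTopology (Fin (S + 1) → Fin (S + 1) → ℝ))
  have hK : IsCompact (Set.univ.pi fun k => Set.Icc (0 : ℝ) 1 ×ˢ P.subSet k) :=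
    isCompact_univ_pi fun k => isCompact_Icc.prod (isCompact_subSet hP hc k)
  obtain ⟨u, -, φ, hφ, hlim⟩ := hK.tendsto_subseq (x := fun t k => (b t k, H t k)) fun t k _ => by
    refine ⟨?_, (hH t k).mem_subSet⟩
    simp only [b]
    split_ifs <;> simp
  rw [tendsto_pi_nhds] at hlim
  set e' := e / (2 * (C + 1))
  have he' : 0 < e' := by positivity
  have hev : ∀ᶠ n in atTop, ∀ k, |b (φ n) k - (u k).1| < 1 / 2 ∧
      entrySum (H (φ n) k - (u k).2) < e' := by
    rw [eventually_all]
    intro k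
    have h1 : Tendsto (fun n => b (φ n) k) atTop (𝓝 (u k).1) :=
      (continuous_fst.tendsto _).comp (hlim k)
    have h2 : Tendsto (fun n => H (φ n) k) atTop (𝓝 (u k).2) :=
      (continuous_snd.tendsto _).comp (hlim k)
    have h3 : Tendsto (fun n => |b (φ n) k - (u k).1|) atTop (𝓝 0) := by
      have := (h1.sub_const (u k).1).abs
      simpa using this
    have h4 : Tendsto (fun n => entrySum (H (φ n) k - (u k).2)) atTop (𝓝 0) := by
      have := (continuous_entrySum.tendsto _).comp (h2.sub_const (u k).2)
      have h0 : entrySum ((u k).2 - (u k).2) = 0 := by rw [sub_self]; simp [entrySum]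
      rw [h0] at this
      exact this
    exact (h3.eventually_lt_const (by norm_num)).and (h4.eventually_lt_const he')
  obtain ⟨n, hn⟩ := eventually_atTop.1 hev
  set m := max n T + 1
  refine ⟨φ m, (le_max_right n T).trans ((Nat.le_succ _).trans (hφ.id_le m)), fun k => ?_⟩
  have hnm : n < m := Nat.lt_succ_of_le (le_max_left n T)
  have hnn : 0 ≤ e * (1 + |(z (φ m)).θ|) := by positivity
  by_cases hv : ((z (φ m)).s k : EReal) < P.Zdual k (z (φ m)).x (z (φ m)).θ
  · obtain ⟨hb1, hH1⟩ := hn n le_rfl k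
    obtain ⟨hb2, hH2⟩ := hn m hnm.le k
    have hv' : ((z (φ n)).s k : EReal) < P.Zdual k (z (φ n)).x (z (φ n)).θ := by
      by_contra hv'
      simp only [b, if_pos hv, if_neg hv'] at hb1 hb2
      rw [abs_lt] at hb1 hb2
      linarith [hb1.1, hb2.2]
    -- The cut generated at iteration `φ n` is present from iteration `φ n + 1` on, hence respected
    -- by the master point at `φ m`.
    have hcut := (hz (φ m)).optCuts k _ (hmono k (hφ hnm : φ n + 1 ≤ φ m) (hHV (φ n) k hv'))
    rw [(hH (φ m) k).Zdual_eq, EReal.coe_le_coe_iff]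
    have hlip := hC _ (hz (φ m)).mem (z (φ m)).θ (H (φ m) k - H (φ n) k)
    rw [← dualLin_apply, map_sub, dualLin_apply, dualLin_apply] at hlip
    have h5 := entrySum_sub_le (H (φ m) k) (H (φ n) k) (u k).2
    have h6 : entrySum (H (φ m) k - H (φ n) k) ≤ 2 * e' := by linarith
    have h7 : C * (1 + |(z (φ m)).θ|) * entrySum (H (φ m) k - H (φ n) k) ≤
        C * (1 + |(z (φ m)).θ|) * (2 * e') :=
      mul_le_mul_of_nonneg_left h6 (by positivity)
    have h8 : C * (2 * e') ≤ e := by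
      have : (C + 1) * (2 * e') = e := by simp only [e']; field_simp
      linarith
    have h9 := mul_le_mul_of_nonneg_right h8 (by positivity : 0 ≤ 1 + |(z (φ m)).θ|)
    have h10 := (abs_le.1 hlip).2
    linarith
  · exact (not_lt.1 hv).trans (EReal.coe_le_coe_iff.2 (by linarith))

/-- Finite convergence: a run of the algorithm stops. -/
theorem not_exists_infinite_run (hP : P.Standing) (hX : IsCompact P.X) (hne : P.X.Nonempty)
    (hc : P.CompleteRecourseLDR) (hexp : P.SufficientlyExpensiveRecourse) (hJ : P.JPDR ≠ 0)
    {tol : ℝ} (htol : 0 < tol) {acc : ℕ → ℝ} (hacc_pos : ∀ t, 0 < acc t)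
    (hacc : Tendsto acc atTop (𝓝 0)) :
    ¬ ∃ st : ℕ → AlgState N₁ S L K, st 0 = AlgState.init N₁ S L K ∧
      ∀ t, P.Step tol (acc t) (st t) (st (t + 1)) := by
  rintro ⟨st, hst0, hstep⟩
  have hreach : ∀ t, P.Reachable tol acc t (st t) := fun t => by
    induction t with
    | zero => rw [hst0]; exact Reachable.start
    | succ t ih => exact Reachable.step ih (hstep t)
  have hsound := fun t => sound_of_reachable hP hc (hreach t)
  choose z hout hns hu using hstep
  have hz := fun t => (hout t).feasible
  obtain ⟨j, hj⟩ := exists_JPDR_eq_coe hP hX hne hc hexp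
  have hj0 : 0 < |j| := abs_pos.2 fun h => hJ (by rw [hj, h]; rfl)
  obtain ⟨c₀, C, hc₀, hC0, hcoer⟩ := exists_coercive hP hX hne hexp
  -- The admissible absolute gap: it solves `d = tol * (|j| - d)`, and `|j| - d` bounds `|u|` and
  -- `|l|` from below.
  set d := tol * |j| / (1 + tol)
  have hd : 0 < d := by positivity
  have hdtol : d * (1 + tol) = tol * |j| := by simp only [d]; field_simp
  -- From `c₀ |θ| - C ≤ obj + e (1 + |θ|)` with `obj ≤ |j| + 1`, `e ≤ 1` and `e ≤ c₀ / 2`.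
  set B := 2 * (|j| + 2 + C) / c₀
  have hB : 0 < B := by positivity
  set e := min (min (c₀ / 2) 1) (d / (2 * (1 + B)))
  have he : 0 < e := by positivity
  have he1 : e ≤ c₀ / 2 := (min_le_left _ _).trans (min_le_left _ _)
  have he2 : e ≤ 1 := (min_le_left _ _).trans (min_le_right _ _)
  have he3 : e * (1 + B) ≤ d / 2 := by
    have := mul_le_mul_of_nonneg_right (min_le_right (min (c₀ / 2) 1) (d / (2 * (1 + B))))
      (by positivity : 0 ≤ 1 + B)
    refine this.trans (le_of_eq ?_)
    field_simp
  -- Half of `d` is left for the repair of violations; the last term makes `-(1 / acc t)` low enough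
  -- to contradict `j ≤ u` if the master value is below it.
  set a₀ := min (min 1 (d / 2)) (1 / (|j| + d + 1))
  have ha₀ : 0 < a₀ := by positivity
  obtain ⟨T, hT⟩ := eventually_atTop.1 (hacc.eventually_lt_const ha₀)
  obtain ⟨t, hTt, hviol⟩ := exists_small_violation hP hX hc hz hu (mul_pos he hP.delta_pos) T
  have ha := hacc_pos t
  have hat := hT t hTt
  have ha1 : acc t ≤ 1 := hat.le.trans ((min_le_left _ _).trans (min_le_left _ _))
  have ha2 : acc t ≤ d / 2 := hat.le.trans ((min_le_left _ _).trans (min_le_right _ _))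
  have ha3 : |j| + d + 1 ≤ 1 / acc t := by
    rw [le_one_div (by positivity) ha]
    exact hat.le.trans (min_le_right _ _)
  have hcand := candidate_le_of_Zdual_le (hz t).conic hviol
  have hdiv : e * P.δ * (1 + |(z t).θ|) / P.δ = e * (1 + |(z t).θ|) := by
    have := hP.delta_pos.ne'
    field_simp
  rw [hdiv] at hcand
  have hjabs := le_abs_self j
  have hjabs' := neg_abs_le j
  -- an upper bound for the objective value of the master point
  have hobj : P.obj (z t) ≤ |j| + 1 := by
    rcases (hout t).obj_le ha with ⟨l, hl, h⟩ | h
    · have hlj := (hsound t).masterValue_le_JPDR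
      rw [hl, hj, EReal.coe_le_coe_iff] at hlj
      linarith
    · linarith
  -- hence `θ` is bounded
  have hθ : |(z t).θ| ≤ B := by
    have h1 := hcoer ((z t).shift (e * (1 + |(z t).θ|) * P.δ)) (hz t).mem ((hz t).conic.shift _)
      fun k => by
        have := hviol k
        rwa [show e * P.δ * (1 + |(z t).θ|) = e * (1 + |(z t).θ|) * P.δ by ring] at this
    rw [obj_shift, mul_div_cancel_right₀ _ hP.delta_pos.ne'] at h1
    change c₀ * |(z t).θ| - C ≤ _ at h1
    have h2 := mul_le_mul_of_nonneg_right he1 (abs_nonneg (z t).θ)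
    simp only [B]
    rw [le_div_iff₀ hc₀]
    linarith
  have hgap : e * (1 + |(z t).θ|) ≤ d / 2 :=
    (mul_le_mul_of_nonneg_left (by linarith) he.le).trans he3
  obtain ⟨x, θ, hx, -, hval⟩ := (hsound t).exists_newInc hP hc (hz t).mem
  have hub1 : (j : EReal) ≤ P.newUb (st t) (z t) := by
    rw [← hj, ← hval]; exact JPDR_le_pdrValue hx θ
  have hub2 := (newUb_le_candidate (P := P) (st t) (z t)).trans hcand
  obtain ⟨u, hueq⟩ : ∃ u : ℝ, P.newUb (st t) (z t) = (u : EReal) :=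
    ⟨_, (EReal.coe_toReal (hub2.trans_lt (EReal.coe_lt_top _)).ne
      ((EReal.bot_lt_coe _).trans_le hub1).ne').symm⟩
  rw [hueq, EReal.coe_le_coe_iff] at hub1 hub2
  rcases (hout t).obj_le ha with ⟨l, hl, h⟩ | h
  · have hlj := (hsound t).masterValue_le_JPDR
    rw [hl, hj, EReal.coe_le_coe_iff] at hlj
    refine hns t ⟨u, l, hueq, hl, ?_⟩
    have hul : u - l ≤ d := by linarith
    have h1 : |j| - d ≤ |u| := by
      have := abs_sub_abs_le_abs_sub j u
      rw [abs_sub_comm, abs_of_nonneg (by linarith : 0 ≤ u - j)] at this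
      linarith
    have h2 : |j| - d ≤ |l| := by
      have := abs_sub_abs_le_abs_sub j l
      rw [abs_of_nonneg (by linarith : 0 ≤ j - l)] at this
      linarith
    have h3 := mul_le_mul_of_nonneg_left (le_min h1 h2) htol.le
    linarith
  -- Here the repaired master point would give an upper bound below `j`.
  · linarith

/-- If `l` and `v` have the same sign, the smaller absolute value is at most `|j|`. If `l ≤ 0 ≤ v`,
adding the two bounds gives `2 (v - l) ≤ tol (v - l)`, so `tol < 2` forces `v = l`. -/
theorem gap_le_of_stops {tol v l j : ℝ} (htol : 0 < tol) (hlj : l ≤ j) (hjv : j ≤ v)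
    (h : v - l ≤ tol * min |v| |l|) (h2 : tol < 2) : v - j ≤ tol * |j| := by
  have hv := h.trans (mul_le_mul_of_nonneg_left (min_le_left _ _) htol.le)
  have hl := h.trans (mul_le_mul_of_nonneg_left (min_le_right _ _) htol.le)
  rcases le_total 0 l with h0 | h0
  · rw [abs_of_nonneg h0] at hl
    rw [abs_of_nonneg (h0.trans hlj)]
    nlinarith
  rcases le_total v 0 with h1 | h1
  · rw [abs_of_nonpos h1] at hv
    rw [abs_of_nonpos (hjv.trans h1)]
    nlinarith
  · rw [abs_of_nonneg h1] at hv
    rw [abs_of_nonpos h0] at hl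
    have h3 : (2 - tol) * (v - l) ≤ 0 := by linarith
    have h4 : v - l ≤ 0 := nonpos_of_mul_nonpos_right h3 (by linarith)
    have := mul_nonneg htol.le (abs_nonneg j)
    linarith

end Data

end TwoStageDRO

/-! ### The convergence theorem -/

theorem theorem3 {N₁ N₂ S L K N : ℕ} (P : TwoStageDRO.Data N₁ N₂ S L K N)
    (hP : P.Standing)
    (hne : P.X.Nonempty)
    (hX : (IsCompact P.X ∧ Convex ℝ P.X) ∨ P.X.Finite)
    (hcomplete : P.CompleteRecourseLDR)
    (hexpensive : P.SufficientlyExpensiveRecourse)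
    (hJ : P.JPDR ≠ 0)
    (tol : ℝ) (htol : 0 < tol)
    (acc : ℕ → ℝ) (hacc_pos : ∀ t, 0 < acc t) (hacc : Tendsto acc atTop (𝓝 0)) :
    -- no run goes on for ever
    (¬ ∃ st : ℕ → TwoStageDRO.AlgState N₁ S L K,
      st 0 = TwoStageDRO.AlgState.init N₁ S L K ∧
        ∀ t, P.Step tol (acc t) (st t) (st (t + 1))) ∧
    -- no run gets stuck: every iteration can be carried out
    (∀ t st, P.Reachable tol acc t st →
      (∃ z, P.IsMasterOutput (acc t) st z) ∧
      ∀ z, P.IsMasterOutput (acc t) st z → P.Stops tol st z ∨ ∃ st', P.Updates st z st') ∧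
    -- the point that is output when a run stops is optimal up to the tolerance
    (∀ t st z, P.Reachable tol acc t st → P.IsMasterOutput (acc t) st z → P.Stops tol st z →
      ∃ (x : Fin N₁ → ℝ) (θ v l j : ℝ), P.newInc st z = some (x, θ) ∧ x ∈ P.X ∧
        P.pdrValue x θ = (v : EReal) ∧ P.masterValue st = (l : EReal) ∧ P.JPDR = (j : EReal) ∧
        l ≤ j ∧ j ≤ v ∧ v - l ≤ tol * min |v| |l| ∧ (tol < 2 → v - j ≤ tol * |j|)) := by
  have hXc : IsCompact P.X := hX.elim (fun h => h.1) fun h => h.isCompact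
  refine ⟨TwoStageDRO.Data.not_exists_infinite_run hP hXc hne hcomplete hexpensive hJ htol
    hacc_pos hacc, fun t st hst => ?_, fun t st z hst hz hterm => ?_⟩
  · have hs := TwoStageDRO.Data.sound_of_reachable hP hcomplete hst
    exact ⟨hs.exists_isMasterOutput hP hcomplete hne (hacc_pos t),
      fun z _ => Or.inr (TwoStageDRO.Data.exists_updates hP hcomplete st z)⟩
  · have hs := TwoStageDRO.Data.sound_of_reachable hP hcomplete hst
    obtain ⟨v, l, hv, hl, hgap⟩ := hterm
    obtain ⟨j, hj⟩ := TwoStageDRO.Data.exists_JPDR_eq_coe hP hXc hne hcomplete hexpensive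
    obtain ⟨x, θ, hx, hinc, hval⟩ := hs.exists_newInc hP hcomplete hz.feasible.mem
    have hlj := hs.masterValue_le_JPDR
    rw [hl, hj, EReal.coe_le_coe_iff] at hlj
    have hjv := TwoStageDRO.Data.JPDR_le_pdrValue hx θ
    rw [hval, hv, hj, EReal.coe_le_coe_iff] at hjv
    exact ⟨x, θ, v, l, j, hinc, hx, hval.trans hv, hl, hj, hlj, hjv, hgap,
      TwoStageDRO.Data.gap_le_of_stops htol hlj hjv hgap⟩
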